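/- \textbf{Definitions.} A \emph{positive cone} is a cancellative $\mathbb{R}_{\ge0}$-semimodule $P$ with a norm $\|\cdot\|:P\to\mathbb{R}_{\ge0}$ ($\|x\|=0\Rightarrow x=0$, $\|rx\|=r\|x\|$, $\|x+y\|\le\|x\|+\|y\|$) such that $\|x\|\le\|x+y\|$; it is ordered by $x\le y\iff\exists z\; x+z=y$, and $\mathcal{B}P=\{x\in P:\|x\|\le1\}$. It is \emph{complete} if every monotone sequence in $\mathcal{B}P$ has a least upper bound, lying in $\mathcal{B}P$. A linear map between complete positive cones is \emph{continuous} if it preserves least upper bounds of monotone sequences of the unit ball; $P$ is \emph{separated} if the continuous linear maps $P\to\mathbb{R}_{\ge0}$ separate its points. $\mathbf{SCCLin}$ is the category of separated complete positive cones and continuous linear maps $f$ with $f(\mathcal{B}P)\subseteq\mathcal{B}Q$. $P\multimap Q$ is the cone of all continuous linear maps $P\to Q$, with pointwise operations and norm $\sup_{x\in\mathcal{B}P}\|f(x)\|$; it is functorial by $(f\multimap g)(h)=g\circ h\circ f$. $P\& Q$ is the product semimodule $P\times Q$ with the maximum norm, $\top=\{0\}$ and $1=\mathbb{R}_{\ge0}$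 with the identity as norm. A function $f:\mathcal{B}P\to Q$ is \emph{stable} if it is bounded, preserves least upper bounds of monotone sequences of $\mathcal{B}P$, and is totally monotone: for all $n$ and $x_1,\dots,x_n\in P$ with $\sum_i x_i\in\mathcal{B}P$, the sum of $f(\sum_{i\in I}x_i)$ over the $I\subseteq\{1,\dots,n\}$ with $n-\#I$ odd is $\le$ the sum over those with $n-\#I$ even. $\mathbf{SCCStab}$ is the category with the same objects as $\mathbf{SCCLin}$ and as morphisms $P\to Q$ the stable functions with $f(\mathcal{B}P)\subseteq\mathcal{B}Q$; $U:\mathbf{SCCLin}\to\mathbf{SCCStab}$ is the forgetful functor, the identity on objects and the restriction to unit balls on morphisms. \textbf{Theorem.} The functor $U$ has a left adjoint. There is a symmetric monoidal structure $(\otimes,1)$ on $\mathbf{SCCLin}$ with unit $1=\mathbb{R}_{\ge0}$, with a bijection $\mathbf{SCCLin}(P\otimes Q,R)\cong\mathbf{SCCLin}(P,Q\multimap R)$ natural in $P$, $Q$ and $R$, and whose structure isomorphisms are given on pure tensors by $(x\otimes y)\otimes z\mapsto x\otimes(y\otimes z)$, $r\otimes x\mapsto rx$, $x\otimes r\mapsto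 rx$ and $x\otimes y\mapsto y\otimes x$; here $x\otimes y\in P\otimes Q$ is the value at $(x,y)$ of the map $P\to(Q\multimap P\otimes Q)$ that corresponds to $\mathrm{id}_{P\otimes Q}$. For this structure and for every left adjoint $L\dashv U$, let $!=LU$ be the induced comonad on $\mathbf{SCCLin}$, with digging $\delta$, and for $x\in\mathcal{B}P$ let $!x\in\mathcal{B}(!P)$ be the value at $x$ of the unit of the adjunction. Then: \begin{enumerate} \item $!$ is a strong symmetric monoidal comonad from $(\mathbf{SCCLin},\&,\top)$ to $(\mathbf{SCCLin},\otimes,1)$. That is, the functor $!$ is strong symmetric monoidal, with an isomorphism $m^0:1\cong\,!\top$ and natural isomorphisms $m^2_{P,Q}:{!P}\otimes{!Q}\cong{!(P\& Q)}$ satisfying $m^0(1)={!0}$ and $m^2_{P,Q}({!x}\otimes{!y})={!(x,y)}$ for $x\in\mathcal{B}P$, $y\in\mathcal{B}Q$; and, for all $P,Q$, with $\pi_1,\pi_2$ the projections of $P\& Q$, \[ {!\langle{!\pi_1},{!\pi_2}\rangle}\circ\delta_{P\& Q}\circ m^2_{P,Q}=m^2_{!P,!Q}\circ(\delta_P\otimes\delta_Q).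 \] \item The functor from the Kleisli category of $!$ to $\mathbf{SCCStab}$ that is the identity on objects and maps $f:{!P}\to Q$ to the stable function $x\mapsto f(!x)$ is an equivalence of categories. \end{enumerate} -/

import Mathlib

open CategoryTheory MonoidalCategory Opposite
open scoped NNReal

universe u v w

namespace Cones

/-! ### Positive cones -/

/-- A positive cone: a cancellative `ℝ≥0`-semimodule with a norm that is monotone for the
algebraic order. -/
structure PosCone where
  carrier : Type u
  [addCommMonoid : AddCommMonoid carrier]
  [module : Module ℝ≥0 carrier]
  nrm : carrier → ℝ≥0
  eq_zero_of_nrm : ∀ x, nrm x = 0 → x = 0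
  nrm_smul : ∀ (r : ℝ≥0) (x : carrier), nrm (r • x) = r * nrm x
  nrm_add_le : ∀ x y, nrm (x + y) ≤ nrm x + nrm y
  cancel : ∀ x y z : carrier, x + z = y + z → x = y
  nrm_le_add : ∀ x y, nrm x ≤ nrm (x + y)

instance : CoeSort PosCone.{u} (Type u) := ⟨PosCone.carrier⟩

section PosCone

variable (P : PosCone.{u})

instance : AddCommMonoid P.carrier := P.addCommMonoid
instance : Module ℝ≥0 P.carrier := P.module
instance : NNNorm P.carrier := ⟨P.nrm⟩
instance : IsCancelAdd P.carrier :=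
  { add_right_cancel := fun z x y h => P.cancel x y z h
    add_left_cancel := fun z x y h => P.cancel x y z (by simpa [add_comm] using h) }

variable {P}

theorem eq_zero_of_nnnorm {x : P.carrier} (h : ‖x‖₊ = 0) : x = 0 := P.eq_zero_of_nrm x h
theorem nnnorm_smul' (r : ℝ≥0) (x : P.carrier) : ‖r • x‖₊ = r * ‖x‖₊ := P.nrm_smul r x
theorem nnnorm_add_le' (x y : P.carrier) : ‖x + y‖₊ ≤ ‖x‖₊ + ‖y‖₊ := P.nrm_add_le x y
theorem nnnorm_zero' : ‖(0 : P.carrier)‖₊ = 0 := by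
  simpa using nnnorm_smul' (0 : ℝ≥0) (0 : P.carrier)

/-- The algebraic order: `x ≤ y` iff `x + z = y` for some `z`. -/
instance : PartialOrder P.carrier where
  le x y := ∃ z, x + z = y
  le_refl x := ⟨0, add_zero x⟩
  le_trans := by
    rintro x _ _ ⟨a, rfl⟩ ⟨b, rfl⟩
    exact ⟨a + b, (add_assoc _ _ _).symm⟩
  le_antisymm := by
    rintro x _ ⟨a, rfl⟩ ⟨b, hb⟩
    have h0 : a + b = 0 := by
      apply add_left_cancel (a := x)
      rw [← add_assoc, hb, add_zero]
    have ha : a = 0 := by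
      apply P.eq_zero_of_nrm
      have := P.nrm_le_add a b
      rw [h0] at this
      exact le_antisymm (this.trans_eq nnnorm_zero') (zero_le)
    rw [ha, add_zero]

theorem le_def {x y : P.carrier} : x ≤ y ↔ ∃ z, x + z = y := Iff.rfl

instance : IsOrderedAddMonoid P.carrier where
  add_le_add_left := by
    rintro x _ ⟨a, rfl⟩ z
    exact ⟨a, by abel⟩

instance : CanonicallyOrderedAdd P.carrier where
  exists_add_of_le := fun ⟨z, hz⟩ => ⟨z, hz.symm⟩
  le_add_self _ b := ⟨b, add_comm _ _⟩
  le_self_add _ b := ⟨b, rfl⟩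

theorem le_of_add_le {x y z : P.carrier} (h : z + x ≤ z + y) : x ≤ y := by
  obtain ⟨w, hw⟩ := h
  exact ⟨w, add_left_cancel (a := z) (by rw [← add_assoc, hw])⟩

theorem nnnorm_mono {x y : P.carrier} (h : x ≤ y) : ‖x‖₊ ≤ ‖y‖₊ := by
  obtain ⟨z, rfl⟩ := h
  exact P.nrm_le_add x z

theorem smul_mono' (r : ℝ≥0) {x y : P.carrier} (h : x ≤ y) : r • x ≤ r • y := by
  obtain ⟨z, rfl⟩ := h
  exact ⟨r • z, (smul_add _ _ _).symm⟩

theorem isLUB_smul' {r : ℝ≥0} (hr : r ≠ 0) {u : ℕ → P.carrier} {x : P.carrier}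
    (hx : IsLUB (Set.range u) x) : IsLUB (Set.range fun n => r • u n) (r • x) := by
  constructor
  · rintro _ ⟨n, rfl⟩
    exact smul_mono' r (hx.1 ⟨n, rfl⟩)
  · intro y hy
    have : x ≤ r⁻¹ • y := hx.2 (by
      rintro _ ⟨n, rfl⟩
      have := smul_mono' r⁻¹ (hy ⟨n, rfl⟩)
      simpa [smul_smul, hr] using this)
    simpa [smul_smul, hr] using smul_mono' r this

theorem isLUB_const_add {u : ℕ → P.carrier} {x : P.carrier} (a : P.carrier)
    (hx : IsLUB (Set.range u) x) : IsLUB (Set.range fun n => a + u n) (a + x) := by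
  constructor
  · rintro _ ⟨n, rfl⟩
    exact add_le_add_right (hx.1 ⟨n, rfl⟩) a
  · intro y hy
    have hay : a ≤ y := le_trans ⟨u 0, rfl⟩ (hy ⟨0, rfl⟩)
    obtain ⟨w, rfl⟩ := hay
    refine add_le_add_right (hx.2 ?_) a
    rintro _ ⟨n, rfl⟩
    exact le_of_add_le (hy ⟨n, rfl⟩)

theorem isLUB_add {u v : ℕ → P.carrier} {x y : P.carrier} (hu : Monotone u) (hv : Monotone v)
    (hx : IsLUB (Set.range u) x) (hy : IsLUB (Set.range v) y) :
    IsLUB (Set.range fun n => u n + v n) (x + y) := by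
  constructor
  · rintro _ ⟨n, rfl⟩
    exact add_le_add (hx.1 ⟨n, rfl⟩) (hy.1 ⟨n, rfl⟩)
  · intro z hz
    refine (isLUB_const_add x hy).2 ?_
    rintro _ ⟨m, rfl⟩
    dsimp only
    rw [add_comm]
    refine (isLUB_const_add (v m) hx).2 ?_
    rintro _ ⟨n, rfl⟩
    dsimp only
    rw [add_comm]
    exact (add_le_add (hu (le_max_left n m)) (hv (le_max_right n m))).trans (hz ⟨max n m, rfl⟩)

end PosCone

/-- Every monotone sequence in the unit ball has a least upper bound, which lies in the unit
ball. -/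
def PosCone.IsComplete (P : PosCone.{u}) : Prop :=
  ∀ x : ℕ → P, Monotone x → (∀ n, ‖x n‖₊ ≤ 1) → ∃ y : P, ‖y‖₊ ≤ 1 ∧ IsLUB (Set.range x) y

/-- Complete positive cones. -/
structure CompleteCone extends PosCone.{u} where
  complete : toPosCone.IsComplete

instance : CoeSort CompleteCone.{u} (Type u) := ⟨fun P => P.carrier⟩

theorem exists_lub {P : CompleteCone.{u}} (r : ℝ≥0) {x : ℕ → P} (hx : Monotone x)
    (hr : ∀ n, ‖x n‖₊ ≤ r) : ∃ y, ‖y‖₊ ≤ r ∧ IsLUB (Set.range x) y := by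
  rcases eq_or_ne r 0 with rfl | h0
  · have : ∀ n, x n = 0 := fun n => eq_zero_of_nnnorm (le_antisymm (hr n) zero_le)
    refine ⟨0, nnnorm_zero'.le, ?_, fun _ _ => zero_le⟩
    rintro _ ⟨n, rfl⟩
    exact (this n).le
  · obtain ⟨y, hy, hl⟩ := P.complete (fun n => r⁻¹ • x n) (fun _ _ h => smul_mono' _ (hx h))
      (fun n => by
        rw [nnnorm_smul', inv_mul_le_iff₀ (pos_iff_ne_zero.2 h0), mul_one]
        exact hr n)
    refine ⟨r • y, ?_, ?_⟩
    · rw [nnnorm_smul']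
      exact mul_le_of_le_one_right' hy
    · simpa [smul_smul, h0] using isLUB_smul' h0 hl

/-- The norm is Scott-continuous. -/
theorem nnnorm_lub_le {P : CompleteCone.{u}} {r : ℝ≥0} {x : ℕ → P} {y : P} (hx : Monotone x)
    (hr : ∀ n, ‖x n‖₊ ≤ r) (hy : IsLUB (Set.range x) y) : ‖y‖₊ ≤ r := by
  obtain ⟨z, hz, hl⟩ := exists_lub r hx hr
  rwa [hy.unique hl]

/-- The cone `ℝ≥0`, with the identity as norm (in an arbitrary universe). -/
def realCone : CompleteCone.{u} where
  carrier := ULift.{u} ℝ≥0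
  nrm x := x.down
  eq_zero_of_nrm x h := ULift.ext _ _ h
  nrm_smul _ _ := rfl
  nrm_add_le _ _ := le_rfl
  cancel x y z h := ULift.ext _ _ (add_right_cancel (congrArg ULift.down h))
  nrm_le_add x y := le_self_add
  complete x hx h1 := by
    have hle : ∀ a b : ULift.{u} ℝ≥0, (∃ z, a + z = b) ↔ a.down ≤ b.down := fun a b =>
      ⟨by rintro ⟨z, rfl⟩; exact le_self_add,
       fun h => ⟨⟨b.down - a.down⟩, ULift.ext _ _ (add_tsub_cancel_of_le h)⟩⟩
    have hb : BddAbove (Set.range fun n => (x n).down) := ⟨1, by rintro _ ⟨n, rfl⟩; exact h1 n⟩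
    refine ⟨⟨⨆ n, (x n).down⟩, ciSup_le h1, ?_, ?_⟩
    · rintro _ ⟨n, rfl⟩
      exact (hle _ _).2 (le_ciSup hb n)
    · intro y hy
      exact (hle _ _).2 (ciSup_le fun n => (hle _ _).1 (hy ⟨n, rfl⟩))

/-! ### Linear and continuous maps -/

/-- Linear and (Scott-)continuous maps, i.e. the elements of `P ⊸ Q`; no bound on the norm. -/
structure LinMap (P : CompleteCone.{u}) (Q : CompleteCone.{v}) where
  toFun : P → Q
  map_add' : ∀ x y, toFun (x + y) = toFun x + toFun y
  map_smul' : ∀ (r : ℝ≥0) x, toFun (r • x) = r • toFun x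
  continuous' : ∀ (x : ℕ → P) (y : P), Monotone x → (∀ n, ‖x n‖₊ ≤ 1) →
    IsLUB (Set.range x) y → IsLUB (Set.range fun n => toFun (x n)) (toFun y)

namespace LinMap

variable {P : CompleteCone.{u}} {Q : CompleteCone.{v}} {R : CompleteCone.{w}}

instance : FunLike (LinMap P Q) P Q where
  coe := toFun
  coe_injective f g h := by cases f; cases g; cases h; rfl

@[ext] theorem ext {f g : LinMap P Q} (h : ∀ x, f x = g x) : f = g := DFunLike.ext _ _ h

@[simp] theorem map_add (f : LinMap P Q) (x y : P) : f (x + y) = f x + f y := f.map_add' x y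
@[simp] theorem map_smul (f : LinMap P Q) (r : ℝ≥0) (x : P) : f (r • x) = r • f x :=
  f.map_smul' r x
@[simp] theorem map_zero (f : LinMap P Q) : f 0 = 0 := by
  simpa using f.map_smul 0 0

theorem mono (f : LinMap P Q) {x y : P} (h : x ≤ y) : f x ≤ f y := by
  obtain ⟨z, rfl⟩ := h
  exact ⟨f z, (f.map_add _ _).symm⟩

theorem continuous_of_bdd (f : LinMap P Q) {x : ℕ → P} {y : P} (r : ℝ≥0) (hx : Monotone x)
    (hr : ∀ n, ‖x n‖₊ ≤ r) (hy : IsLUB (Set.range x) y) :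
    IsLUB (Set.range fun n => f (x n)) (f y) := by
  have hs : r + 1 ≠ 0 := by positivity
  have := f.continuous' (fun n => (r + 1)⁻¹ • x n) ((r + 1)⁻¹ • y)
    (fun _ _ h => smul_mono' _ (hx h))
    (fun n => by
      rw [nnnorm_smul', inv_mul_le_iff₀ (pos_iff_ne_zero.2 hs), mul_one]
      exact (hr n).trans le_self_add) (isLUB_smul' (inv_ne_zero hs) hy)
  have h2 := isLUB_smul' hs this
  change IsLUB (Set.range fun n => (r + 1) • f ((r + 1)⁻¹ • x n)) ((r + 1) • f ((r + 1)⁻¹ • y)) at h2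
  simpa [smul_smul, hs] using h2

/-- A linear and continuous map is bounded on the unit ball. -/
theorem bounded (f : LinMap P Q) : ∃ C : ℝ≥0, ∀ x, ‖x‖₊ ≤ 1 → ‖f x‖₊ ≤ C := by
  by_contra! hcon
  choose x hx1 hx2 using fun n : ℕ => hcon (2 ^ n * 2 ^ (n + 1))
  let s : ℕ → P := fun n => ∑ k ∈ Finset.range n, ((2 : ℝ≥0)⁻¹ ^ (k + 1)) • x k
  have hs : ∀ n, s (n + 1) = s n + ((2 : ℝ≥0)⁻¹ ^ (n + 1)) • x n := fun n =>
    Finset.sum_range_succ _ _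
  have hmono : Monotone s := monotone_nat_of_le_succ fun n => ⟨_, (hs n).symm⟩
  have hnorm : ∀ n, ‖s n‖₊ + 2⁻¹ ^ n ≤ 1 := by
    intro n
    induction n with
    | zero => simp [s, nnnorm_zero']
    | succ n ih =>
      refine le_trans ?_ ih
      rw [hs]
      have h1 : ‖((2 : ℝ≥0)⁻¹ ^ (n + 1)) • x n‖₊ ≤ 2⁻¹ ^ (n + 1) := by
        rw [nnnorm_smul']
        exact mul_le_of_le_one_right' (hx1 n)
      calc _ ≤ (‖s n‖₊ + 2⁻¹ ^ (n + 1)) + 2⁻¹ ^ (n + 1) := by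
            gcongr
            exact (nnnorm_add_le' _ _).trans (by gcongr)
        _ = ‖s n‖₊ + 2⁻¹ ^ n := by
            rw [add_assoc, pow_succ, ← mul_add]
            congr 1
            rw [← two_mul, mul_inv_cancel₀ two_ne_zero, mul_one]
  obtain ⟨y, -, hy⟩ := P.complete s hmono fun n => le_self_add.trans (hnorm n)
  obtain ⟨n, hn⟩ := pow_unbounded_of_one_lt ‖f y‖₊ (one_lt_two (α := ℝ≥0))
  have h1 : ((2 : ℝ≥0)⁻¹ ^ (n + 1)) • f (x n) ≤ f y := by
    rw [← map_smul]
    refine f.mono (le_trans ?_ (hy.1 ⟨n + 1, rfl⟩))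
    rw [hs]
    exact le_add_self
  have h2 := nnnorm_mono h1
  rw [nnnorm_smul'] at h2
  have h3 : (2 : ℝ≥0) ^ n ≤ 2⁻¹ ^ (n + 1) * ‖f (x n)‖₊ := by
    calc (2 : ℝ≥0) ^ n = 2⁻¹ ^ (n + 1) * (2 ^ n * 2 ^ (n + 1)) := by
          rw [mul_left_comm, ← mul_pow, inv_mul_cancel₀ two_ne_zero, one_pow, mul_one]
      _ ≤ _ := by gcongr; exact (hx2 n).le
  exact absurd (h3.trans h2) (not_le.2 hn)

/-- The norm `‖f‖ = sup { ‖f x‖ | ‖x‖ ≤ 1 }` of a linear and continuous map. -/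
noncomputable instance : NNNorm (LinMap P Q) :=
  ⟨fun f => ⨆ x : {x : P // ‖x‖₊ ≤ 1}, ‖f x.1‖₊⟩

theorem nnnorm_def (f : LinMap P Q) : ‖f‖₊ = ⨆ x : {x : P // ‖x‖₊ ≤ 1}, ‖f x.1‖₊ := rfl

theorem bddAbove (f : LinMap P Q) :
    BddAbove (Set.range fun x : {x : P // ‖x‖₊ ≤ 1} => ‖f x.1‖₊) := by
  obtain ⟨C, hC⟩ := f.bounded
  exact ⟨C, by rintro _ ⟨x, rfl⟩; exact hC _ x.2⟩

theorem nnnorm_le_iff (f : LinMap P Q) (r : ℝ≥0) :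
    ‖f‖₊ ≤ r ↔ ∀ x, ‖x‖₊ ≤ 1 → ‖f x‖₊ ≤ r := by
  have : Nonempty {x : P // ‖x‖₊ ≤ 1} := ⟨⟨0, by rw [nnnorm_zero']; exact zero_le⟩⟩
  rw [nnnorm_def, ciSup_le_iff f.bddAbove]
  exact Subtype.forall

theorem nnnorm_apply_le (f : LinMap P Q) (x : P) : ‖f x‖₊ ≤ ‖f‖₊ * ‖x‖₊ := by
  rcases eq_or_ne ‖x‖₊ 0 with h | h
  · rw [eq_zero_of_nnnorm h, map_zero, nnnorm_zero']
    exact zero_le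
  · have := (f.nnnorm_le_iff _).1 le_rfl (‖x‖₊⁻¹ • x) (by
      rw [nnnorm_smul', inv_mul_cancel₀ h])
    rwa [map_smul, nnnorm_smul', inv_mul_le_iff₀ (pos_iff_ne_zero.2 h), mul_comm] at this

/-- The identity. -/
def id (P : CompleteCone.{u}) : LinMap P P :=
  ⟨fun x => x, fun _ _ => rfl, fun _ _ => rfl, fun _ _ _ _ h => h⟩

/-- Composition. -/
def comp (g : LinMap Q R) (f : LinMap P Q) : LinMap P R where
  toFun x := g (f x)
  map_add' x y := by simp
  map_smul' r x := by simp
  continuous' x y hx h1 hy :=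
    g.continuous_of_bdd ‖f‖₊ (fun _ _ h => f.mono (hx h))
      (fun n => (f.nnnorm_le_iff _).1 le_rfl _ (h1 n)) (f.continuous' x y hx h1 hy)

@[simp] theorem comp_apply (g : LinMap Q R) (f : LinMap P Q) (x : P) :
    g.comp f x = g (f x) := rfl
@[simp] theorem id_apply (x : P) : LinMap.id P x = x := rfl
@[simp] theorem mk_apply (f : P → Q) (h1 h2 h3) (x : P) : LinMap.mk f h1 h2 h3 x = f x := rfl

instance : Zero (LinMap P Q) :=
  ⟨⟨fun _ => 0, by simp, by simp, fun _ _ _ _ _ => by simp [isLUB_singleton]⟩⟩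

instance : Add (LinMap P Q) :=
  ⟨fun f g => ⟨fun x => f x + g x, fun x y => by simp; abel, fun r x => by simp,
    fun x y hx h1 hy => isLUB_add (fun _ _ h => f.mono (hx h)) (fun _ _ h => g.mono (hx h))
      (f.continuous' x y hx h1 hy) (g.continuous' x y hx h1 hy)⟩⟩

noncomputable instance : SMul ℝ≥0 (LinMap P Q) :=
  ⟨fun r f => ⟨fun x => r • f x, fun x y => by simp, fun s x => by simp [smul_comm r s],
    fun x y hx h1 hy => by
      rcases eq_or_ne r 0 with rfl | hr
      · simp [isLUB_singleton]
      · exact isLUB_smul' hr (f.continuous' x y hx h1 hy)⟩⟩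

@[simp] theorem zero_apply (x : P) : (0 : LinMap P Q) x = 0 := rfl
@[simp] theorem add_apply (f g : LinMap P Q) (x : P) : (f + g) x = f x + g x := rfl
@[simp] theorem smul_apply (r : ℝ≥0) (f : LinMap P Q) (x : P) : (r • f) x = r • f x := rfl

instance : AddCommMonoid (LinMap P Q) where
  add_assoc f g h := by ext; simp [add_assoc]
  zero_add f := by ext; simp
  add_zero f := by ext; simp
  add_comm f g := by ext; simp [add_comm]
  nsmul := nsmulRec

noncomputable instance : Module ℝ≥0 (LinMap P Q) where
  one_smul f := by ext; simp
  mul_smul r s f := by ext; simp [mul_smul]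
  smul_zero r := by ext; simp
  smul_add r f g := by ext; simp
  add_smul r s f := by ext; simp [add_smul]
  zero_smul f := by ext; simp

/-- Pointwise comparison of linear and continuous maps yields a linear and continuous
difference. -/
theorem exists_sub {f g : LinMap P Q} (h : ∀ x, f x ≤ g x) : ∃ k, f + k = g := by
  choose d hd using h
  have hmono : ∀ {x y}, x ≤ y → d x ≤ d y := by
    rintro x _ ⟨z, rfl⟩
    refine ⟨d z, add_left_cancel (a := f x + f z) ?_⟩
    rw [← map_add, hd, map_add, map_add, ← hd, ← hd]
    abel
  refine ⟨⟨d, fun x y => ?_, fun r x => ?_, fun x y hx h1 hy => ⟨?_, ?_⟩⟩, ext fun x => hd x⟩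
  · apply add_left_cancel (a := f (x + y))
    rw [hd, map_add, map_add, ← hd x, ← hd y]
    abel
  · apply add_left_cancel (a := f (r • x))
    rw [hd, map_smul, map_smul, ← hd x, smul_add]
  · rintro _ ⟨n, rfl⟩
    exact hmono (hy.1 ⟨n, rfl⟩)
  · intro z hz
    refine le_of_add_le (z := f y) ?_
    rw [hd]
    refine (g.continuous' x y hx h1 hy).2 ?_
    rintro _ ⟨n, rfl⟩
    change g (x n) ≤ _
    rw [← hd]
    exact add_le_add (f.mono (hy.1 ⟨n, rfl⟩)) (hz ⟨n, rfl⟩)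

end LinMap

/-- Lubs of sequences of linear and continuous maps are computed pointwise. -/
theorem LinMap.isLUB_of_pointwise {P : CompleteCone.{u}} {Q : CompleteCone.{v}}
    {u : ℕ → LinMap P Q} {f : LinMap P Q} (hf : ∀ x, IsLUB (Set.range fun n => u n x) (f x)) :
    (∀ n, ∃ k, u n + k = f) ∧ ∀ g, (∀ n, ∃ k, u n + k = g) → ∃ k, f + k = g := by
  refine ⟨fun n => exists_sub fun x => (hf x).1 ⟨n, rfl⟩, fun g hg => exists_sub fun x => ?_⟩
  refine (hf x).2 ?_
  rintro _ ⟨n, rfl⟩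
  obtain ⟨k, rfl⟩ := hg n
  exact le_self_add

theorem LinMap.exists_pointwise_lub {P : CompleteCone.{u}} {Q : CompleteCone.{v}}
    {u : ℕ → LinMap P Q} (hu : ∀ x, Monotone fun n => u n x) (r : ℝ≥0) (hr : ∀ n, ‖u n‖₊ ≤ r) :
    ∃ f : LinMap P Q, ‖f‖₊ ≤ r ∧ ∀ x, IsLUB (Set.range fun n => u n x) (f x) := by
  have hb : ∀ n x, ‖u n x‖₊ ≤ r * ‖x‖₊ := fun n x =>
    ((u n).nnnorm_apply_le x).trans (by gcongr; exact hr n)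
  choose F hF1 hF2 using fun x => exists_lub (r * ‖x‖₊) (hu x) fun n => hb n x
  refine ⟨⟨F, fun x y => ?_, fun s x => ?_, fun x y hx h1 hy => ⟨?_, ?_⟩⟩, ?_, hF2⟩
  · refine (hF2 (x + y)).unique ?_
    simpa using isLUB_add (hu x) (hu y) (hF2 x) (hF2 y)
  · rcases eq_or_ne s 0 with rfl | hs
    · have := hF1 ((0 : ℝ≥0) • x)
      rw [zero_smul, nnnorm_zero', mul_zero] at this
      rw [zero_smul, zero_smul]
      exact eq_zero_of_nnnorm (le_antisymm this zero_le)
    · refine (hF2 (s • x)).unique ?_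
      simpa using isLUB_smul' hs (hF2 x)
  · rintro _ ⟨k, rfl⟩
    refine (hF2 _).2 ?_
    rintro _ ⟨n, rfl⟩
    exact ((u n).mono (hy.1 ⟨k, rfl⟩)).trans ((hF2 y).1 ⟨n, rfl⟩)
  · intro z hz
    refine (hF2 y).2 ?_
    rintro _ ⟨n, rfl⟩
    refine ((u n).continuous' x y hx h1 hy).2 ?_
    rintro _ ⟨k, rfl⟩
    exact ((hF2 (x k)).1 ⟨n, rfl⟩).trans (hz ⟨k, rfl⟩)
  · rw [LinMap.nnnorm_le_iff]
    exact fun x hx => (hF1 x).trans (mul_le_of_le_one_right' hx)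

/-- The cone of linear and continuous maps, with pointwise operations and
`‖f‖ = sup { ‖f x‖ | ‖x‖ ≤ 1 }`. -/
noncomputable def linCone (P : CompleteCone.{u}) (Q : CompleteCone.{v}) :
    CompleteCone.{max u v} where
  carrier := LinMap P Q
  nrm f := ‖f‖₊
  eq_zero_of_nrm f h := by
    ext x
    refine eq_zero_of_nnnorm (le_antisymm ?_ zero_le)
    simpa [h] using f.nnnorm_apply_le x
  nrm_smul r f := by
    rw [LinMap.nnnorm_def, LinMap.nnnorm_def, NNReal.mul_iSup]
    simp [nnnorm_smul']
  nrm_add_le f g := by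
    rw [LinMap.nnnorm_le_iff]
    intro x hx
    exact (nnnorm_add_le' _ _).trans (add_le_add ((f.nnnorm_le_iff _).1 le_rfl x hx)
      ((g.nnnorm_le_iff _).1 le_rfl x hx))
  cancel f g h e := by
    ext x
    exact add_right_cancel (b := h x) (DFunLike.congr_fun e x)
  nrm_le_add f g := by
    rw [LinMap.nnnorm_le_iff]
    intro x hx
    exact (nnnorm_mono le_self_add).trans (((f + g).nnnorm_le_iff _).1 le_rfl x hx)
  complete u hu h1 := by
    obtain ⟨f, hf, hl⟩ := LinMap.exists_pointwise_lub (u := u)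
      (fun x m n h => by
        obtain ⟨k, hk⟩ := hu h
        exact ⟨(show LinMap P Q from k) x, DFunLike.congr_fun hk x⟩) 1 h1
    obtain ⟨hl1, hl2⟩ := LinMap.isLUB_of_pointwise hl
    refine ⟨f, hf, ?_, fun g hg => hl2 g fun n => hg ⟨n, rfl⟩⟩
    rintro _ ⟨n, rfl⟩
    exact hl1 n

/-- Elements of the cone of linear and continuous maps are functions. -/
instance (P : CompleteCone.{u}) (Q : CompleteCone.{v}) : FunLike (linCone P Q) P Q :=
  inferInstanceAs (FunLike (LinMap P Q) P Q)

theorem linCone_isLUB_iff {P : CompleteCone.{u}} {Q : CompleteCone.{v}}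
    {u : ℕ → linCone P Q} (hu : Monotone u) (h1 : ∀ n, ‖u n‖₊ ≤ 1) {f : linCone P Q} :
    IsLUB (Set.range u) f ↔
      ∀ x, IsLUB (Set.range fun n => u n x) (f x) := by
  have key : ∀ g : linCone P Q,
      (∀ x, IsLUB (Set.range fun n => u n x) (g x)) → IsLUB (Set.range u) g := by
    intro g hg
    obtain ⟨hl1, hl2⟩ := LinMap.isLUB_of_pointwise (u := u) (f := g) hg
    refine ⟨?_, fun g hg => hl2 g fun n => hg ⟨n, rfl⟩⟩
    rintro _ ⟨n, rfl⟩
    exact hl1 n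
  refine ⟨fun h => ?_, key f⟩
  obtain ⟨g, -, hl⟩ := LinMap.exists_pointwise_lub (u := u)
    (fun x m n h => by
      obtain ⟨k, hk⟩ := hu h
      exact ⟨k x, DFunLike.congr_fun hk x⟩) 1 h1
  rw [h.unique (key g hl)]
  exact hl

/-- Linear and continuous maps into `ℝ≥0` separate the points. -/
def CompleteCone.IsSeparated (P : CompleteCone.{u}) : Prop :=
  ∀ x y : P, (∀ f : LinMap P realCone.{0}, f x = f y) → x = y

end Cones

open Cones

/-! ### The category of cones and linear maps -/

/-- Separated complete positive cones. -/
structure SCCLin extends CompleteCone.{u} where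
  separated : toCompleteCone.IsSeparated

namespace Cones

instance : CoeSort SCCLin.{u} (Type u) := ⟨fun P => P.carrier⟩

/-- Morphisms of cones: linear and continuous maps that preserve the unit balls. -/
structure LinHom (P Q : SCCLin.{u}) extends LinMap P.toCompleteCone Q.toCompleteCone where
  map_ball : ∀ x, ‖x‖₊ ≤ 1 → ‖toFun x‖₊ ≤ 1

instance : Category SCCLin.{u} where
  Hom := LinHom
  id P := ⟨LinMap.id _, fun _ h => h⟩
  comp f g := ⟨g.toLinMap.comp f.toLinMap, fun x h => g.map_ball _ (f.map_ball x h)⟩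

instance (P Q : SCCLin.{u}) : FunLike (P ⟶ Q) P Q where
  coe f := LinHom.toLinMap f
  coe_injective f g h := by
    obtain ⟨f, _⟩ := f
    obtain ⟨g, _⟩ := g
    obtain rfl : f = g := DFunLike.coe_injective h
    rfl

@[ext] theorem hom_ext {P Q : SCCLin.{u}} {f g : P ⟶ Q} (h : ∀ x, f x = g x) : f = g :=
  DFunLike.ext _ _ h

@[simp] theorem id_apply' (P : SCCLin.{u}) (x : P) : (𝟙 P : P ⟶ P) x = x := rfl
@[simp] theorem comp_apply' {P Q R : SCCLin.{u}} (f : P ⟶ Q) (g : Q ⟶ R) (x : P) :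
    (f ≫ g) x = g (f x) := rfl

theorem realCone_le {a b : realCone.{u}} : a ≤ b ↔ ULift.down a ≤ ULift.down b :=
  ⟨by rintro ⟨z, rfl⟩; exact le_self_add,
   fun h => ⟨⟨ULift.down b - ULift.down a⟩, ULift.ext _ _ (add_tsub_cancel_of_le h)⟩⟩

/-- The change of universe of the cone `ℝ≥0`. -/
def realDown : LinMap realCone.{u} realCone.{0} where
  toFun x := ⟨ULift.down x⟩
  map_add' _ _ := rfl
  map_smul' _ _ := rfl
  continuous' x y _ _ hy := by
    refine ⟨?_, fun z hz => ?_⟩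
    · rintro _ ⟨n, rfl⟩
      have h1 := realCone_le.1 (hy.1 ⟨n, rfl⟩)
      exact realCone_le.2 h1
    · have h : y ≤ (show realCone.{u} from ⟨ULift.down z⟩) := by
        refine (isLUB_le_iff hy).2 ?_
        rintro _ ⟨n, rfl⟩
        have h1 := realCone_le.1 (hz ⟨n, rfl⟩)
        exact realCone_le.2 h1
      have h2 := realCone_le.1 h
      exact realCone_le.2 h2

/-- The cone `1 = ℝ≥0`, as an object. -/
def unitCone : SCCLin.{u} where
  toCompleteCone := realCone.{u}
  separated _ _ h := by
    have h1 := congrArg (fun z : realCone.{0} => ULift.down z) (h realDown)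
    exact ULift.ext _ _ h1

/-- The linear function space `P ⊸ Q`. -/
noncomputable def limpl (P Q : SCCLin.{u}) : SCCLin.{u} where
  toCompleteCone := linCone P.toCompleteCone Q.toCompleteCone
  separated f g h := LinMap.ext fun x => Q.separated _ _ fun y' =>
    h ⟨fun k => y' ((show linCone P.toCompleteCone Q.toCompleteCone from k) x),
      fun _ _ => y'.map_add _ _, fun _ _ => y'.map_smul _ _, fun u k hu h1 hk =>
        y'.continuous_of_bdd (1 * ‖x‖₊)
          (fun m n hmn => by
            obtain ⟨d, hd⟩ := hu hmn
            exact ⟨(show linCone P.toCompleteCone Q.toCompleteCone from d) x,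
              DFunLike.congr_fun hd x⟩)
          (fun n => (LinMap.nnnorm_apply_le _ x).trans (by gcongr; exact h1 n))
          ((linCone_isLUB_iff hu h1).1 hk x)⟩

/-- Elements of `P ⊸ Q` are functions. -/
instance (P Q : SCCLin.{u}) : FunLike (limpl P Q) P Q :=
  inferInstanceAs (FunLike (LinMap P.toCompleteCone Q.toCompleteCone) P Q)

/-- `(f ⊸ g) h = g ∘ h ∘ f`. -/
noncomputable def limplMap {P₁ P₂ Q₁ Q₂ : SCCLin.{u}} (f : P₂ ⟶ P₁) (g : Q₁ ⟶ Q₂) :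
    limpl P₁ Q₁ ⟶ limpl P₂ Q₂ where
  toFun h := g.toLinMap.comp (LinMap.comp h f.toLinMap)
  map_add' h k := LinMap.ext fun x => g.toLinMap.map_add _ _
  map_smul' r h := LinMap.ext fun x => g.toLinMap.map_smul _ _
  continuous' u k hu h1 hk := by
    obtain ⟨hl1, hl2⟩ := LinMap.isLUB_of_pointwise
      (u := fun n => g.toLinMap.comp (LinMap.comp (u n) f.toLinMap))
      (f := g.toLinMap.comp (LinMap.comp k f.toLinMap)) (fun x =>
        g.toLinMap.continuous_of_bdd (1 * ‖f x‖₊)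
          (fun m n hmn => by
            obtain ⟨d, hd⟩ := hu hmn
            exact ⟨(show linCone P₁.toCompleteCone Q₁.toCompleteCone from d) (f x),
              DFunLike.congr_fun hd (f x)⟩)
          (fun n => (LinMap.nnnorm_apply_le _ (f x)).trans (by gcongr; exact h1 n))
          ((linCone_isLUB_iff hu h1).1 hk (f x)))
    refine ⟨?_, fun z hz => hl2 z fun n => hz ⟨n, rfl⟩⟩
    rintro _ ⟨n, rfl⟩
    exact hl1 n
  map_ball h h1 := (LinMap.nnnorm_le_iff _ _).2 fun x hx =>
    g.map_ball _ ((LinMap.nnnorm_le_iff _ _).1 h1 _ (f.map_ball x hx))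

/-- The functor `(P, Q) ↦ (P ⊸ Q)`. -/
noncomputable def limplFunctor : SCCLin.{u}ᵒᵖ ⥤ SCCLin.{u} ⥤ SCCLin.{u} where
  obj P :=
    { obj := fun Q => limpl P.unop Q
      map := fun g => limplMap (𝟙 _) g }
  map f := { app := fun Q => limplMap f.unop (𝟙 Q) }

/-! ### Finite products of cones -/

/-- The zero cone `⊤`. -/
def topCone : SCCLin.{u} where
  carrier := PUnit.{u + 1}
  module := PUnit.module
  nrm _ := 0
  eq_zero_of_nrm _ _ := rfl
  nrm_smul _ _ := by simp
  nrm_add_le _ _ := by simp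
  cancel _ _ _ _ := rfl
  nrm_le_add _ _ := le_rfl
  complete _ _ _ := ⟨PUnit.unit, zero_le, by rintro _ ⟨n, rfl⟩; exact ⟨PUnit.unit, rfl⟩,
    fun _ _ => ⟨PUnit.unit, rfl⟩⟩
  separated _ _ _ := rfl

/-- The cone structure on `P × Q`, with the maximum norm. -/
def withPosCone (P Q : PosCone.{u}) : PosCone.{u} where
  carrier := P × Q
  nrm x := max ‖x.1‖₊ ‖x.2‖₊
  eq_zero_of_nrm x h := by
    obtain ⟨h1, h2⟩ := max_le_iff.1 h.le
    exact Prod.ext (eq_zero_of_nnnorm (le_antisymm h1 zero_le))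
      (eq_zero_of_nnnorm (le_antisymm h2 zero_le))
  nrm_smul r x := by
    change max ‖r • x.1‖₊ ‖r • x.2‖₊ = _
    rw [nnnorm_smul', nnnorm_smul', mul_max]
  nrm_add_le x y := max_le
    ((nnnorm_add_le' _ _).trans (add_le_add (le_max_left _ _) (le_max_left _ _)))
    ((nnnorm_add_le' _ _).trans (add_le_add (le_max_right _ _) (le_max_right _ _)))
  cancel x y z h := Prod.ext (add_right_cancel (congrArg Prod.fst h))
    (add_right_cancel (congrArg Prod.snd h))
  nrm_le_add x y := max_le_max (nnnorm_mono le_self_add) (nnnorm_mono le_self_add)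

theorem with_le_iff {P Q : PosCone.{u}} {x y : withPosCone P Q} :
    x ≤ y ↔ x.1 ≤ y.1 ∧ x.2 ≤ y.2 := by
  constructor
  · rintro ⟨z, rfl⟩
    exact ⟨⟨z.1, rfl⟩, ⟨z.2, rfl⟩⟩
  · rintro ⟨⟨a, ha⟩, ⟨b, hb⟩⟩
    exact ⟨(a, b), Prod.ext ha hb⟩

theorem with_isLUB_iff {P Q : PosCone.{u}} {u : ℕ → withPosCone P Q} {x : withPosCone P Q} :
    IsLUB (Set.range u) x ↔
      IsLUB (Set.range fun n => (u n).1) x.1 ∧ IsLUB (Set.range fun n => (u n).2) x.2 := by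
  constructor
  · intro h
    have hu : ∀ n, u n ≤ x := fun n => h.1 ⟨n, rfl⟩
    refine ⟨⟨?_, fun y hy => ?_⟩, ⟨?_, fun y hy => ?_⟩⟩
    · rintro _ ⟨n, rfl⟩
      exact (with_le_iff.1 (hu n)).1
    · suffices hx : x ≤ (show withPosCone P Q from (y, x.2)) from (with_le_iff.1 hx).1
      refine (isLUB_le_iff h).2 ?_
      rintro _ ⟨n, rfl⟩
      exact with_le_iff.2 ⟨hy ⟨n, rfl⟩, (with_le_iff.1 (hu n)).2⟩
    · rintro _ ⟨n, rfl⟩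
      exact (with_le_iff.1 (hu n)).2
    · suffices hx : x ≤ (show withPosCone P Q from (x.1, y)) from (with_le_iff.1 hx).2
      refine (isLUB_le_iff h).2 ?_
      rintro _ ⟨n, rfl⟩
      exact with_le_iff.2 ⟨(with_le_iff.1 (hu n)).1, hy ⟨n, rfl⟩⟩
  · rintro ⟨h1, h2⟩
    refine ⟨?_, fun y hy => ?_⟩
    · rintro _ ⟨n, rfl⟩
      exact with_le_iff.2 ⟨h1.1 ⟨n, rfl⟩, h2.1 ⟨n, rfl⟩⟩
    · refine with_le_iff.2 ⟨h1.2 ?_, h2.2 ?_⟩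
      · rintro _ ⟨n, rfl⟩
        exact (with_le_iff.1 (hy ⟨n, rfl⟩)).1
      · rintro _ ⟨n, rfl⟩
        exact (with_le_iff.1 (hy ⟨n, rfl⟩)).2

/-- The product cone `P & Q`, without separation. -/
def withCone (P Q : CompleteCone.{u}) : CompleteCone.{u} where
  toPosCone := withPosCone P.toPosCone Q.toPosCone
  complete u hu h1 := by
    obtain ⟨x, hx, hx'⟩ := P.complete (fun n => (u n).1) (fun _ _ h => (with_le_iff.1 (hu h)).1)
      (fun n => (le_max_left _ _).trans (h1 n))
    obtain ⟨y, hy, hy'⟩ := Q.complete (fun n => (u n).2) (fun _ _ h => (with_le_iff.1 (hu h)).2)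
      (fun n => (le_max_right _ _).trans (h1 n))
    exact ⟨(x, y), max_le hx hy, with_isLUB_iff.2 ⟨hx', hy'⟩⟩

/-- The first projection, as a linear and continuous map. -/
def fstMap (P Q : CompleteCone.{u}) : LinMap (withCone P Q) P :=
  ⟨fun x => x.1, fun _ _ => rfl, fun _ _ => rfl, fun _ _ _ _ h => (with_isLUB_iff.1 h).1⟩

/-- The second projection, as a linear and continuous map. -/
def sndMap (P Q : CompleteCone.{u}) : LinMap (withCone P Q) Q :=
  ⟨fun x => x.2, fun _ _ => rfl, fun _ _ => rfl, fun _ _ _ _ h => (with_isLUB_iff.1 h).2⟩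

/-- The product `P & Q`: the product semimodule with the maximum norm. -/
def withObj (P Q : SCCLin.{u}) : SCCLin.{u} where
  toCompleteCone := withCone P.toCompleteCone Q.toCompleteCone
  separated _ _ h := Prod.ext
    (P.separated _ _ fun f => h (f.comp (fstMap _ _)))
    (Q.separated _ _ fun f => h (f.comp (sndMap _ _)))

/-- The projection `P & Q ⟶ P`. -/
def withFst (P Q : SCCLin.{u}) : withObj P Q ⟶ P where
  toLinMap := fstMap _ _
  map_ball _ h := (le_max_left _ _).trans h

/-- The projection `P & Q ⟶ Q`. -/
def withSnd (P Q : SCCLin.{u}) : withObj P Q ⟶ Q where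
  toLinMap := sndMap _ _
  map_ball _ h := (le_max_right _ _).trans h

/-- The pairing `x ↦ (f x, g x)`. -/
def withLift {P Q R : SCCLin.{u}} (f : R ⟶ P) (g : R ⟶ Q) : R ⟶ withObj P Q where
  toFun x := (f x, g x)
  map_add' x y := Prod.ext (f.toLinMap.map_add x y) (g.toLinMap.map_add x y)
  map_smul' r x := Prod.ext (f.toLinMap.map_smul r x) (g.toLinMap.map_smul r x)
  continuous' _ _ hx h1 hy := with_isLUB_iff.2
    ⟨f.continuous' _ _ hx h1 hy, g.continuous' _ _ hx h1 hy⟩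
  map_ball x h := max_le (f.map_ball x h) (g.map_ball x h)

/-- The map into the zero cone. -/
def toTop (P : SCCLin.{u}) : P ⟶ topCone.{u} where
  toFun _ := PUnit.unit
  map_add' _ _ := rfl
  map_smul' _ _ := rfl
  continuous' _ _ _ _ _ := ⟨by rintro _ ⟨n, rfl⟩; exact ⟨PUnit.unit, rfl⟩,
    fun _ _ => ⟨PUnit.unit, rfl⟩⟩
  map_ball _ _ := zero_le

end Cones

/-- A copy of the category `SCCLin`, to carry the cartesian monoidal structure `(&, ⊤)`. -/
def SCCLinWith : Type (u + 1) := SCCLin.{u}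

namespace Cones

instance : Category SCCLinWith.{u} := inferInstanceAs (Category SCCLin.{u})

/-- The cartesian monoidal structure given by the products `P & Q` and `⊤`. -/
instance : CartesianMonoidalCategory SCCLinWith.{u} where
  tensorObj P Q := withObj P Q
  tensorUnit := topCone.{u}
  tensorHom {P₁ P₂ Q₁ Q₂} f g := withLift (withFst P₁ Q₁ ≫ f) (withSnd P₁ Q₁ ≫ g)
  whiskerLeft P {Q₁ Q₂} g := withLift (withFst P Q₁) (withSnd P Q₁ ≫ g)
  whiskerRight {P₁ P₂} f Q := withLift (withFst P₁ Q ≫ f) (withSnd P₁ Q)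
  associator P Q R :=
    { hom := withLift (withFst (withObj P Q) R ≫ withFst P Q)
        (withLift (withFst (withObj P Q) R ≫ withSnd P Q) (withSnd (withObj P Q) R))
      inv := withLift (withLift (withFst P (withObj Q R)) (withSnd P (withObj Q R) ≫ withFst Q R))
        (withSnd P (withObj Q R) ≫ withSnd Q R) }
  leftUnitor P := { hom := withSnd topCone P, inv := withLift (toTop P) (𝟙 P) }
  rightUnitor P := { hom := withFst P topCone, inv := withLift (𝟙 P) (toTop P) }
  isTerminalTensorUnit := Limits.IsTerminal.ofUniqueHom (fun P => toTop P) (fun _ _ => rfl)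
  fst P Q := withFst P Q
  snd P Q := withSnd P Q
  tensorProductIsBinaryProduct P Q := Limits.BinaryFan.IsLimit.mk _
    (fun f g => withLift f g) (fun _ _ => rfl) (fun _ _ => rfl)
    (fun f g m h1 h2 => by subst h1 h2; rfl)

/-- The symmetry `P & Q ≅ Q & P`. -/
instance : SymmetricCategory SCCLinWith.{u} where
  braiding P Q := { hom := withLift (withSnd P Q) (withFst P Q),
                    inv := withLift (withSnd Q P) (withFst Q P) }

end Cones

/-! ### Stable functions -/

namespace Cones

section Decomposition

variable {M : Type*} [AddCommMonoid M]

/-- The sum of `F I` over the `I ⊆ S` such that `#S - #I` is even. -/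
def evenSum {ι : Type*} (S : Finset ι) (F : Finset ι → M) : M :=
  ∑ I ∈ S.powerset with Even (S.card - I.card), F I

/-- The sum of `F I` over the `I ⊆ S` such that `#S - #I` is odd. -/
def oddSum {ι : Type*} (S : Finset ι) (F : Finset ι → M) : M :=
  ∑ I ∈ S.powerset with Odd (S.card - I.card), F I

variable {ι : Type*}

theorem evenSum_congr {S : Finset ι} {F G : Finset ι → M} (h : ∀ I ⊆ S, F I = G I) :
    evenSum S F = evenSum S G :=
  Finset.sum_congr rfl fun _ hI => h _ (Finset.mem_powerset.1 (Finset.mem_filter.1 hI).1)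

theorem oddSum_congr {S : Finset ι} {F G : Finset ι → M} (h : ∀ I ⊆ S, F I = G I) :
    oddSum S F = oddSum S G :=
  Finset.sum_congr rfl fun _ hI => h _ (Finset.mem_powerset.1 (Finset.mem_filter.1 hI).1)

theorem evenSum_add (S : Finset ι) (F G : Finset ι → M) :
    evenSum S (fun I => F I + G I) = evenSum S F + evenSum S G := Finset.sum_add_distrib

theorem oddSum_add (S : Finset ι) (F G : Finset ι → M) :
    oddSum S (fun I => F I + G I) = oddSum S F + oddSum S G := Finset.sum_add_distrib

variable [DecidableEq ι]

theorem evenSum_insert {a : ι} {S : Finset ι} (ha : a ∉ S) (F : Finset ι → M) :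
    evenSum (insert a S) F = oddSum S F + evenSum S (fun I => F (insert a I)) := by
  unfold evenSum oddSum
  simp only [Finset.sum_filter]
  rw [Finset.sum_powerset_insert ha]
  congr 1
  · refine Finset.sum_congr rfl fun I hI => ?_
    have h1 := Finset.card_le_card (Finset.mem_powerset.1 hI)
    rw [Finset.card_insert_of_notMem ha]
    have : Even (S.card + 1 - I.card) ↔ Odd (S.card - I.card) := by
      rw [Nat.succ_sub h1, Nat.succ_eq_add_one, Nat.even_add_one, Nat.not_even_iff_odd]
    simp only [this]
  · refine Finset.sum_congr rfl fun I hI => ?_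
    have h2 : a ∉ I := fun h => ha (Finset.mem_powerset.1 hI h)
    rw [Finset.card_insert_of_notMem ha, Finset.card_insert_of_notMem h2, Nat.add_sub_add_right]

theorem oddSum_insert {a : ι} {S : Finset ι} (ha : a ∉ S) (F : Finset ι → M) :
    oddSum (insert a S) F = evenSum S F + oddSum S (fun I => F (insert a I)) := by
  unfold evenSum oddSum
  simp only [Finset.sum_filter]
  rw [Finset.sum_powerset_insert ha]
  congr 1
  · refine Finset.sum_congr rfl fun I hI => ?_
    have h1 := Finset.card_le_card (Finset.mem_powerset.1 hI)
    rw [Finset.card_insert_of_notMem ha]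
    have : Odd (S.card + 1 - I.card) ↔ Even (S.card - I.card) := by
      rw [Nat.succ_sub h1, Nat.succ_eq_add_one, Nat.odd_add_one, Nat.not_odd_iff_even]
    simp only [this]
  · refine Finset.sum_congr rfl fun I hI => ?_
    have h2 : a ∉ I := fun h => ha (Finset.mem_powerset.1 hI h)
    rw [Finset.card_insert_of_notMem ha, Finset.card_insert_of_notMem h2, Nat.add_sub_add_right]

theorem oddSum_add_eq_evenSum (S : Finset ι) (d : Finset ι → M) :
    oddSum S (fun I => ∑ J ∈ I.powerset, d J) + d S =
      evenSum S (fun I => ∑ J ∈ I.powerset, d J) := by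
  induction S using Finset.induction_on generalizing d with
  | empty => simp [oddSum, evenSum]
  | insert a S ha ih =>
    rw [oddSum_insert ha, evenSum_insert ha]
    have h : ∀ I ⊆ S, ∑ J ∈ (insert a I).powerset, d J =
        ∑ J ∈ I.powerset, d J + ∑ J ∈ I.powerset, d (insert a J) := fun I hI =>
      Finset.sum_powerset_insert (fun h => ha (hI h)) d
    rw [oddSum_congr h, evenSum_congr h, oddSum_add, evenSum_add, ← ih fun J => d (insert a J)]
    abel

theorem exists_decomposition [IsCancelAdd M] {F : Finset ι → M}
    (h : ∀ S, ∃ d, oddSum S F + d = evenSum S F) :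
    ∃ d : Finset ι → M, ∀ S, F S = ∑ J ∈ S.powerset, d J := by
  choose d hd using h
  refine ⟨d, fun S => ?_⟩
  induction S using Finset.strongInduction with
  | H S ih =>
    have hS := oddSum_add_eq_evenSum S d
    have hodd : oddSum S F = oddSum S (fun I => ∑ J ∈ I.powerset, d J) := by
      refine Finset.sum_congr rfl fun I hI => ?_
      obtain ⟨h1, h2⟩ := Finset.mem_filter.1 hI
      refine ih I (Finset.ssubset_iff_subset_ne.2 ⟨Finset.mem_powerset.1 h1, ?_⟩)
      rintro rfl
      simp at h2
    have hmem : S ∈ S.powerset.filter fun I => Even (S.card - I.card) := by simp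
    have heven : ∀ G : Finset ι → M, evenSum S G =
        G S + ∑ I ∈ (S.powerset.filter fun I => Even (S.card - I.card)).erase S, G I :=
      fun G => (Finset.add_sum_erase _ _ hmem).symm
    rw [← hodd, hd, heven, heven] at hS
    refine add_right_cancel (hS.trans (congrArg _ (Finset.sum_congr rfl fun I hI => ?_)))
    obtain ⟨h1, h2⟩ := Finset.mem_erase.1 hI
    exact (ih I (Finset.ssubset_iff_subset_ne.2
      ⟨Finset.mem_powerset.1 (Finset.mem_filter.1 h2).1, h1⟩)).symm

end Decomposition

/-- The unit ball of a cone. -/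
def Ball (P : PosCone.{u}) : Type u := {x : P // ‖x‖₊ ≤ 1}

instance (P : PosCone.{u}) : PartialOrder (Ball P) := inferInstanceAs (PartialOrder {_x : P // _})

theorem nnnorm_sum_le_one {P : PosCone.{u}} {ι : Type*} {S I : Finset ι} {x : ι → P}
    (h : ‖∑ i ∈ S, x i‖₊ ≤ 1) (hI : I ⊆ S) : ‖∑ i ∈ I, x i‖₊ ≤ 1 :=
  (nnnorm_mono (Finset.sum_le_sum_of_subset hI)).trans h

/-- The element `∑ i ∈ I, x i` of the unit ball, for a finite family with sum in the unit ball. -/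
def ballSum {P : PosCone.{u}} {n : ℕ} (x : Fin n → P) (h : ‖∑ i, x i‖₊ ≤ 1)
    (I : Finset (Fin n)) : Ball P :=
  ⟨∑ i ∈ I, x i, nnnorm_sum_le_one h (Finset.subset_univ I)⟩

/-- Stable functions: functions on the unit ball that are bounded, totally monotone and
Scott-continuous. -/
structure IsStable {P : CompleteCone.{u}} {Q : CompleteCone.{v}}
    (f : Ball P.toPosCone → Q) : Prop where
  bounded : ∃ C : ℝ≥0, ∀ x, ‖f x‖₊ ≤ C
  totallyMonotone : ∀ (n : ℕ) (x : Fin n → P) (h : ‖∑ i, x i‖₊ ≤ 1),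
    oddSum Finset.univ (fun I => f (ballSum x h I)) ≤
      evenSum Finset.univ (fun I => f (ballSum x h I))
  continuous : ∀ (x : ℕ → Ball P.toPosCone) (y : Ball P.toPosCone), Monotone x →
    IsLUB (Set.range fun n => (x n).1) y.1 → IsLUB (Set.range fun n => f (x n)) (f y)

section Total

variable {P : CompleteCone.{u}} {Q : CompleteCone.{v}} {R : CompleteCone.{w}}

open Classical in
/-- Extension by zero of a function on the unit ball. -/
noncomputable def ballExtend (f : Ball P.toPosCone → Q) (x : P) : Q :=
  if h : ‖x‖₊ ≤ 1 then f ⟨x, h⟩ else 0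

theorem ballExtend_of_le (f : Ball P.toPosCone → Q) {x : P} (h : ‖x‖₊ ≤ 1) :
    ballExtend f x = f ⟨x, h⟩ := dif_pos h

/-- A totally monotone function is, on the partial sums of a finite family, a sum of
contributions of the subfamilies. -/
theorem IsStable.exists_decomposition {f : Ball P.toPosCone → Q} (hf : IsStable f)
    {ι : Type*} [Fintype ι] [DecidableEq ι] (x : ι → P) (hx : ‖∑ i, x i‖₊ ≤ 1) :
    ∃ d : Finset ι → Q, ∀ S, ballExtend f (∑ i ∈ S, x i) = ∑ J ∈ S.powerset, d J := by
  refine Cones.exists_decomposition fun S => ?_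
  have hS := nnnorm_sum_le_one hx (Finset.subset_univ S)
  let e : Fin S.card ↪ ι := S.equivFin.symm.toEmbedding.trans (Function.Embedding.subtype _)
  have hmap : ∀ I : Finset (Fin S.card), I.map e ⊆ S := by
    intro I i hi
    obtain ⟨j, -, rfl⟩ := Finset.mem_map.1 hi
    exact (S.equivFin.symm j).2
  have huniv : Finset.univ.map e = S := Finset.eq_of_subset_of_card_le (hmap _) (by simp)
  have hsum : ∀ I : Finset (Fin S.card), ∑ i ∈ I, x (e i) = ∑ i ∈ I.map e, x i := fun I =>
    (Finset.sum_map _ _ _).symm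
  have hy : ‖∑ i, x (e i)‖₊ ≤ 1 := by rwa [hsum, huniv]
  have key := hf.totallyMonotone S.card (fun i => x (e i)) hy
  have hpow : S.powerset = Finset.univ.powerset.map (Finset.mapEmbedding e).toEmbedding := by
    ext I
    simp only [Finset.mem_powerset, Finset.mem_map, Finset.powerset_univ, Finset.mem_univ,
      true_and]
    constructor
    · intro hI
      rw [← huniv] at hI
      obtain ⟨J, -, hJ⟩ := Finset.subset_map_iff.1 hI
      exact ⟨J, hJ.symm⟩
    · rintro ⟨J, rfl⟩
      exact hmap J
  have hval : ∀ I : Finset (Fin S.card), f (ballSum (fun i => x (e i)) hy I) =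
      ballExtend f (∑ i ∈ I.map e, x i) := by
    intro I
    rw [ballExtend_of_le f (nnnorm_sum_le_one hS (hmap I))]
    congr 1
    exact Subtype.ext (hsum I)
  obtain ⟨d, hd⟩ := key
  refine ⟨d, ?_⟩
  simp only [oddSum, evenSum, Finset.sum_filter] at hd ⊢
  rw [hpow, Finset.sum_map, Finset.sum_map]
  simp only [hval] at hd
  simpa using hd

theorem totallyMonotone_of_decomposition {f : Ball P.toPosCone → Q} {n : ℕ} {x : Fin n → P}
    {h : ‖∑ i, x i‖₊ ≤ 1} (d : Finset (Fin n) → Q)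
    (hd : ∀ I, f (ballSum x h I) = ∑ J ∈ I.powerset, d J) :
    oddSum Finset.univ (fun I => f (ballSum x h I)) ≤
      evenSum Finset.univ (fun I => f (ballSum x h I)) := by
  simp only [hd]
  exact ⟨_, oddSum_add_eq_evenSum Finset.univ d⟩

theorem IsStable.mono {f : Ball P.toPosCone → Q} (hf : IsStable f) {x y : Ball P.toPosCone}
    (h : x ≤ y) : f x ≤ f y := by
  have hl := hf.continuous (fun n => if n = 0 then x else y) y
    (monotone_nat_of_le_succ fun n => by
      rcases n with _ | n
      · simpa using h
      · simp)
    ⟨by rintro _ ⟨n, rfl⟩; rcases n with _ | n; exacts [h, le_rfl], fun z hz => hz ⟨1, rfl⟩⟩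
  exact hl.1 ⟨0, rfl⟩

/-- Stable functions compose. -/
theorem IsStable.comp {g : Ball Q.toPosCone → R} {f : Ball P.toPosCone → Ball Q.toPosCone}
    (hg : IsStable g) (hf : IsStable fun x => (f x).1) : IsStable fun x => g (f x) where
  bounded := hg.bounded.imp fun _ h x => h _
  totallyMonotone n x hx := by
    obtain ⟨d, hd⟩ := hf.exists_decomposition x hx
    have hfd : ∀ I, (f (ballSum x hx I)).1 = ∑ J ∈ I.powerset, d J := fun I => by
      rw [← hd, ballExtend_of_le _ (nnnorm_sum_le_one hx (Finset.subset_univ I))]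
      rfl
    have hdu : ‖∑ J, d J‖₊ ≤ 1 := by
      have := (f (ballSum x hx Finset.univ)).2
      rwa [hfd, Finset.powerset_univ] at this
    obtain ⟨e, he⟩ := hg.exists_decomposition d hdu
    refine totallyMonotone_of_decomposition (f := fun x => g (f x))
      (fun S => ∑ K : Finset (Finset (Fin n)) with K.sup _root_.id = S, e K) fun I => ?_
    have h1 : g (f (ballSum x hx I)) = ballExtend g (∑ J ∈ I.powerset, d J) := by
      rw [← hfd, ballExtend_of_le _ (f (ballSum x hx I)).2]
      rfl
    rw [h1, he]
    have h2 : ∀ K : Finset (Finset (Fin n)), K ∈ I.powerset.powerset ↔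
        K.sup _root_.id ∈ I.powerset := fun K => by
      rw [Finset.mem_powerset, Finset.mem_powerset, Finset.sup_le_iff]
      exact ⟨fun h J hJ => Finset.mem_powerset.1 (h hJ),
        fun h J hJ => Finset.mem_powerset.2 (h J hJ)⟩
    rw [← Finset.sum_fiberwise_of_maps_to (fun K hK => (h2 K).1 hK)]
    refine Finset.sum_congr rfl fun S hS => Finset.sum_congr ?_ fun _ _ => rfl
    ext K
    simp only [Finset.mem_filter, Finset.mem_univ, true_and, h2, and_iff_right_iff_imp]
    rintro rfl
    exact hS
  continuous x y hx hy :=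
    hg.continuous (fun n => f (x n)) (f y) (fun _ _ h => hf.mono (hx h)) (hf.continuous x y hx hy)

/-- Linear and continuous maps are stable. -/
theorem LinMap.isStable (f : LinMap P Q) : IsStable fun x : Ball P.toPosCone => f x.1 where
  bounded := ⟨‖f‖₊, fun x => (f.nnnorm_le_iff _).1 le_rfl _ x.2⟩
  totallyMonotone n x hx := by
    refine totallyMonotone_of_decomposition (f := fun x : Ball P.toPosCone => f x.1)
      (fun J => ∑ i with J = {i}, f (x i)) fun I => ?_
    have h1 : f (ballSum x hx I).1 = ∑ i ∈ I, f (x i) := by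
      change f (∑ i ∈ I, x i) = _
      induction I using Finset.induction_on with
      | empty => simp
      | insert a I ha ih => rw [Finset.sum_insert ha, Finset.sum_insert ha, map_add, ih]
    rw [h1]
    simp only [Finset.sum_filter]
    rw [Finset.sum_comm]
    simp
  continuous x y hx hy := f.continuous' _ _ hx (fun n => (x n).2) hy

end Total

end Cones

/-- The category of cones and stable functions has the same objects as `SCCLin`. -/
structure SCCStab where
  /-- The underlying cone. -/
  cone : SCCLin.{u}

namespace Cones

/-- Stable functions of norm at most `1`, i.e. which map the unit ball into the unit ball. -/
structure StabHom (P Q : SCCLin.{u}) where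
  toFun : Ball P.toPosCone → Ball Q.toPosCone
  isStable : IsStable fun x => (toFun x).1

instance : Category SCCStab.{u} where
  Hom P Q := StabHom P.cone Q.cone
  id P := ⟨fun x => x, (LinMap.id P.cone.toCompleteCone).isStable⟩
  comp f g := ⟨fun x => g.toFun (f.toFun x), g.isStable.comp f.isStable⟩

instance (P Q : SCCStab.{u}) : FunLike (P ⟶ Q) (Ball P.cone.toPosCone) (Ball Q.cone.toPosCone) where
  coe f := StabHom.toFun f
  coe_injective f g h := by
    obtain ⟨f, _⟩ := f
    obtain ⟨g, _⟩ := g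
    obtain rfl : f = g := h
    rfl

/-- The forgetful functor from linear to stable morphisms. -/
def stabOfLin : SCCLin.{u} ⥤ SCCStab.{u} where
  obj P := ⟨P⟩
  map f := ⟨fun x => ⟨f x.1, f.map_ball _ x.2⟩, f.toLinMap.isStable⟩

end Cones

/-! ### The tensor product -/

namespace Cones

section Tensor

variable [MonoidalCategory SCCLin.{u}]

/-- The pure tensor `x ⊗ y`: the value at `x` and `y` of the map `P ⟶ (Q ⊸ P ⊗ Q)` associated
with the identity of `P ⊗ Q`. -/
noncomputable def pureTensor (adj : (curriedTensor SCCLin.{u}).flip ⊣₂ limplFunctor) {P Q : SCCLin.{u}}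
    (x : P) (y : Q) : (P ⊗ Q : SCCLin.{u}) :=
  (show limpl Q (P ⊗ Q) from
    (adj.homEquiv (X₁ := Q) (X₂ := P) (X₃ := P ⊗ Q) (𝟙 (P ⊗ Q))) x) y

variable [SymmetricCategory SCCLin.{u}]

/-- The symmetric monoidal structure at hand is the tensor product of cones: the tensor functor
is left adjoint to the linear function space functor, naturally in all variables, the unit is
`ℝ≥0`, and the structure isomorphisms are the usual ones on pure tensors. -/
structure ConeTensor where
  /-- The bijection `(P ⊗ Q ⟶ R) ≃ (P ⟶ (Q ⊸ R))`, natural in `P`, `Q`, `R`. -/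
  adj : (curriedTensor SCCLin.{u}).flip ⊣₂ limplFunctor
  /-- The unit is the cone `ℝ≥0`. -/
  unitIso : unitCone.{u} ≅ 𝟙_ SCCLin.{u}
  associator_pure : ∀ {P Q R : SCCLin.{u}} (x : P) (y : Q) (z : R),
    (α_ P Q R).hom (pureTensor adj (pureTensor adj x y) z) =
      pureTensor adj x (pureTensor adj y z)
  leftUnitor_pure : ∀ {P : SCCLin.{u}} (r : ℝ≥0) (x : P),
    (λ_ P).hom (pureTensor adj (unitIso.hom ⟨r⟩) x) = r • x
  rightUnitor_pure : ∀ {P : SCCLin.{u}} (x : P) (r : ℝ≥0),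
    (ρ_ P).hom (pureTensor adj x (unitIso.hom ⟨r⟩)) = r • x
  braiding_pure : ∀ {P Q : SCCLin.{u}} (x : P) (y : Q),
    (β_ P Q).hom (pureTensor adj x y) = pureTensor adj y x

end Tensor

/-! ### The exponential -/

section Exponential

variable {L : SCCStab.{u} ⥤ SCCLin.{u}} (adj : L ⊣ stabOfLin.{u})

/-- The exponential comonad `!` induced by a left adjoint of the forgetful functor. -/
abbrev bang : Comonad SCCLin.{u} := adj.toComonad

/-- The functor `!`, with the cartesian copy of the category of cones as its source. -/
def bangWith : SCCLinWith.{u} ⥤ SCCLin.{u} := (bang adj).toFunctor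

/-- The universal stable map `x ↦ !x`, from the unit ball of `P` to the unit ball of `!P`:
the unit of the adjunction. -/
def prom {P : SCCLin.{u}} (x : Ball P.toPosCone) : Ball ((bang adj).obj P).toPosCone :=
  adj.homEquiv (stabOfLin.obj P) ((bang adj).obj P) (𝟙 _) x

/-- The element `0` of the unit ball of `⊤`. -/
def topZero : Ball topCone.{u}.toPosCone := ⟨0, nnnorm_zero'.trans_le zero_le⟩

/-- The element `(x, y)` of the unit ball of `P & Q`. -/
def ballPair {P Q : SCCLin.{u}} (x : Ball P.toPosCone) (y : Ball Q.toPosCone) :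
    Ball (withObj P Q).toPosCone :=
  ⟨(x.1, y.1), max_le x.2 y.2⟩

/-- The comparison functor from the Kleisli category of the comonad `!` to the category of cones
and stable functions: it maps `P` to `P` and `f : !P ⟶ Q` to the stable function
`x ↦ f (!x)` which corresponds to `f` by the adjunction. -/
def kleisliComparison : Cokleisli (bang adj) ⥤ SCCStab.{u} where
  obj P := stabOfLin.obj P.of
  map {P Q} f := adj.homEquiv (stabOfLin.obj P.of) Q.of f.of
  map_id P := by
    change adj.homEquiv _ _ (adj.counit.app P.of) = _
    simp [Adjunction.homEquiv_unit]
  map_comp {P Q R} f g := by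
    change adj.homEquiv _ _ (L.map (adj.unit.app (stabOfLin.obj P.of)) ≫
      L.map (stabOfLin.map f.of) ≫ g.of) = _
    refine (adj.homEquiv_naturality_left _ _).trans ?_
    refine (congrArg (adj.unit.app (stabOfLin.obj P.of) ≫ ·)
      (adj.homEquiv_naturality_left (stabOfLin.map f.of) g.of)).trans ?_
    refine (Category.assoc _ _ _).symm.trans ?_
    exact congrArg (· ≫ adj.homEquiv _ _ g.of) (adj.homEquiv_unit (f := f.of)).symm

end Exponential

end Cones
open Cones

/-!
The proof rests on one construction, `exists_universal`. Consider a class of bounded functions from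
a fixed set `A` to cones which contains a function into a subcone of a product as soon as it
contains all its components. Then the class has a universal member: map `A` into the product of the
targets of all members of the class, and take the subcone generated by the image, that is, its
closure under linear combinations, differences, and least upper bounds of bounded monotone
sequences. The components of this map are all the members of the class. The index set of
the product lives in a larger universe, but the generated subcone is small, as its elements are
values of formal expressions (`ConeTerm`) in the elements of `A`. No adjoint functor theorem is
needed.

For bilinear functions on `P × Q` this gives the tensor product. Its symmetric monoidal structure
is determined by, and verified on, pure tensors. For stable functions on the unit ball of `P` it
gives a universal stable map (`IsUniversalStable`), hence the left adjoint of the forgetful functor.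
The unit of every left adjoint is such a universal stable map.

The Seely isomorphisms come from `IsUniversalStable.tens`: if `p : P → X` and `q : Q → Y` are
universal stable maps, then so is `(x, y) ↦ p x ⊗ q y`, as a map `P & Q → X ⊗ Y`. It is stable
because bilinear maps are (`isStable_tmk`). The factorization of a stable `f` on `P & Q` is the
content of `IsUniversalStable.exists_tens_lift`: for fixed `x` the function `f (x, ·)` extends to a
linear map `F x : Y → S`, and `F` must be shown to be stable with values in `Y ⊸ S`. Its
alternating differences are the linear extensions of the alternating differences of `f` in the
first variable, and these are again stable in the second variable
(`exists_isStable_difference`), so they are nonnegative in `Y ⊸ S`. The isomorphisms, and all the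
coherence conditions, then follow from uniqueness, by evaluation at the elements `!x ⊗ !y`.
-/

namespace Cones

/-! ### Cones whose structure is determined by a family of morphisms -/

theorem isLUB_of_reflects_le {P : CompleteCone.{u}} {J : Type w} {R : J → CompleteCone.{v}}
    (π : ∀ j, LinMap P (R j)) (hπ : ∀ x y : P, (∀ j, π j x ≤ π j y) → x ≤ y) {x : ℕ → P} {y : P}
    (h : ∀ j, IsLUB (Set.range fun n => π j (x n)) (π j y)) : IsLUB (Set.range x) y := by
  refine ⟨?_, fun z hz => hπ _ _ fun j => (h j).2 ?_⟩
  · rintro _ ⟨n, rfl⟩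
    exact hπ _ _ fun j => (h j).1 ⟨n, rfl⟩
  · rintro _ ⟨n, rfl⟩
    exact (π j).mono (hz ⟨n, rfl⟩)

/-- A family of morphisms out of a cone that detects the order and the norm, as the projections
of a product or the inclusion of a full subcone do. -/
structure IsInitialFamily {X : SCCLin.{u}} {J : Type w} {R : J → SCCLin.{u}}
    (π : ∀ j, X ⟶ R j) : Prop where
  le : ∀ x y, (∀ j, π j x ≤ π j y) → x ≤ y
  nnnorm_le : ∀ x r, (∀ j, ‖π j x‖₊ ≤ r) → ‖x‖₊ ≤ r

namespace IsInitialFamily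

variable {X : SCCLin.{u}} {J : Type w} {R : J → SCCLin.{u}} {π : ∀ j, X ⟶ R j}

theorem ext (h : IsInitialFamily π) {x y : X} (hxy : ∀ j, π j x = π j y) : x = y :=
  le_antisymm (h.le _ _ fun j => (hxy j).le) (h.le _ _ fun j => (hxy j).ge)

theorem isLUB (h : IsInitialFamily π) {x : ℕ → X} {y : X}
    (hl : ∀ j, IsLUB (Set.range fun n => π j (x n)) (π j y)) : IsLUB (Set.range x) y :=
  isLUB_of_reflects_le (fun j => (π j).toLinMap) h.le hl

end IsInitialFamily

section ConeOfFamily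

variable {X : Type u} [AddCommMonoid X] [Module ℝ≥0 X] {J : Type w} {R : J → SCCLin.{u}}

/-- The conditions under which the cone structure of a family of cones can be pulled back to a
semimodule along a family of linear maps. -/
structure PullsBack (π : ∀ j, X →ₗ[ℝ≥0] R j) : Prop where
  ext : ∀ x y, (∀ j, π j x = π j y) → x = y
  bounded : ∀ x, ∃ C, ∀ j, ‖π j x‖₊ ≤ C
  exists_add : ∀ x y, (∀ j, π j x ≤ π j y) → ∃ z, x + z = y
  exists_lub : ∀ x : ℕ → X, (∀ j, Monotone fun n => π j (x n)) → (∀ j n, ‖π j (x n)‖₊ ≤ 1) →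
    ∃ y, ∀ j, IsLUB (Set.range fun n => π j (x n)) (π j y)

variable {π : ∀ j, X →ₗ[ℝ≥0] R j}

theorem PullsBack.iSup_le_iff (h : PullsBack π) {x : X} {r : ℝ≥0} :
    ⨆ j, ‖π j x‖₊ ≤ r ↔ ∀ j, ‖π j x‖₊ ≤ r := by
  obtain ⟨C, hC⟩ := h.bounded x
  exact ciSup_le_iff' ⟨C, by rintro _ ⟨j, rfl⟩; exact hC j⟩

theorem PullsBack.le_iSup (h : PullsBack π) (x : X) (j : J) : ‖π j x‖₊ ≤ ⨆ j, ‖π j x‖₊ :=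
  h.iSup_le_iff.1 le_rfl j

/-- The positive cone pulled back along a family of linear maps, with the supremum norm. -/
noncomputable def PullsBack.posCone (h : PullsBack π) : PosCone.{u} where
  carrier := X
  nrm x := ⨆ j, ‖π j x‖₊
  eq_zero_of_nrm x hx := h.ext _ _ fun j => by
    rw [map_zero]
    exact eq_zero_of_nnnorm (le_antisymm ((h.le_iSup x j).trans hx.le) zero_le)
  nrm_smul r x := by
    rw [NNReal.mul_iSup]
    simp only [map_smul, nnnorm_smul']
  nrm_add_le x y := h.iSup_le_iff.2 fun j => by
    rw [map_add]
    exact (nnnorm_add_le' _ _).trans (add_le_add (h.le_iSup x j) (h.le_iSup y j))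
  cancel x y z hxy := h.ext _ _ fun j => by
    have := congrArg (π j) hxy
    rw [map_add, map_add] at this
    exact add_right_cancel this
  nrm_le_add x y := h.iSup_le_iff.2 fun j => by
    refine le_trans (nnnorm_mono ?_) (h.le_iSup (x + y) j)
    rw [map_add]
    exact le_self_add

theorem PullsBack.le_iff (h : PullsBack π) {x y : h.posCone} :
    x ≤ y ↔ ∀ j, π j x ≤ π j y := by
  refine ⟨?_, h.exists_add x y⟩
  rintro ⟨z, rfl⟩ j
  exact ⟨π j z, (map_add (π j) x z).symm⟩

theorem PullsBack.isLUB (h : PullsBack π) {x : ℕ → h.posCone} {y : h.posCone}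
    (hl : ∀ j, IsLUB (Set.range fun n => π j (x n)) (π j y)) : IsLUB (Set.range x) y := by
  refine ⟨?_, fun z hz => h.le_iff.2 fun j => (hl j).2 ?_⟩
  · rintro _ ⟨n, rfl⟩
    exact h.le_iff.2 fun j => (hl j).1 ⟨n, rfl⟩
  · rintro _ ⟨n, rfl⟩
    exact h.le_iff.1 (hz ⟨n, rfl⟩) j

theorem PullsBack.exists_isLUB (h : PullsBack π) {x : ℕ → h.posCone} (hx : Monotone x)
    (h1 : ∀ n, ‖x n‖₊ ≤ 1) : ∃ y : h.posCone, ∀ j, IsLUB (Set.range fun n => π j (x n)) (π j y) :=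
  h.exists_lub x (fun j _ _ hmn => h.le_iff.1 (hx hmn) j)
    fun j n => (h.le_iSup (x n) j).trans (h1 n)

/-- The complete cone pulled back along a family of linear maps. -/
noncomputable def PullsBack.completeCone (h : PullsBack π) : CompleteCone.{u} where
  toPosCone := h.posCone
  complete x hx h1 := by
    obtain ⟨y, hy⟩ := h.exists_isLUB hx h1
    refine ⟨y, h.iSup_le_iff.2 fun j => ?_, h.isLUB hy⟩
    exact nnnorm_lub_le (fun m n hmn => h.le_iff.1 (hx hmn) j)
      (fun n => (h.le_iSup (x n) j).trans (h1 n)) (hy j)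

/-- The maps along which a complete cone is pulled back. -/
noncomputable def PullsBack.projLinMap (h : PullsBack π) (j : J) :
    LinMap h.completeCone (R j).toCompleteCone where
  toFun := π j
  map_add' := map_add (π j)
  map_smul' := map_smul (π j)
  continuous' x y hx h1 hy := by
    obtain ⟨z, hz⟩ := h.exists_isLUB hx h1
    rw [hy.unique (h.isLUB hz)]
    exact hz j

/-- The separated complete cone pulled back along a family of linear maps. -/
noncomputable def PullsBack.cone (h : PullsBack π) : SCCLin.{u} where
  toCompleteCone := h.completeCone
  separated _ _ hxy := h.ext _ _ fun j =>
    (R j).separated _ _ fun f => hxy (f.comp (h.projLinMap j))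

/-- The morphisms along which a separated complete cone is pulled back. -/
noncomputable def PullsBack.proj (h : PullsBack π) (j : J) : h.cone ⟶ R j where
  toLinMap := h.projLinMap j
  map_ball x hx := (h.le_iSup x j).trans hx

theorem PullsBack.isInitialFamily (h : PullsBack π) : IsInitialFamily h.proj where
  le _ _ := h.le_iff.2
  nnnorm_le _ _ := h.iSup_le_iff.2

end ConeOfFamily

/-! ### Subcones generated by a set -/

section Generated

variable {A : Type u} {J : Type w} (R : J → SCCLin.{u}) (i : A → ∀ j, R j)

/-- The smallest subset of a product of cones that contains a given set and is closed under
linear combinations, under differences, and under least upper bounds of bounded monotone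
sequences. -/
inductive Generated : (∀ j, R j) → Prop
  | of (a : A) : Generated (i a)
  | zero : Generated 0
  | add {x y : ∀ j, R j} : Generated x → Generated y → Generated (x + y)
  | smul (r : ℝ≥0) {x : ∀ j, R j} : Generated x → Generated (r • x)
  | sub {x y z : ∀ j, R j} : Generated x → Generated y → x + z = y → Generated z
  | lub {x : ℕ → ∀ j, R j} {y : ∀ j, R j} : (∀ n, Generated (x n)) →
      (∀ j, Monotone fun n => x n j) → (∀ j n, ‖x n j‖₊ ≤ 1) →
      (∀ j, IsLUB (Set.range fun n => x n j) (y j)) → Generated y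

/-- Formal expressions for the elements of a generated subcone. -/
inductive ConeTerm (A : Type u) : Type u
  | of (a : A)
  | zero
  | add (s t : ConeTerm A)
  | smul (r : ℝ≥0) (t : ConeTerm A)
  | sub (s t : ConeTerm A)
  | lub (t : ℕ → ConeTerm A)

open Classical in
/-- The value of a formal expression; meaningless differences and least upper bounds have the
value `0`. -/
noncomputable def ConeTerm.eval : ConeTerm A → ∀ j, R j
  | .of a => i a
  | .zero => 0
  | .add s t => s.eval + t.eval
  | .smul r t => r • t.eval
  | .sub s t => if h : ∃ z, s.eval + z = t.eval then h.choose else 0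
  | .lub t => if h : ∃ y : ∀ j, R j, ∀ j, IsLUB (Set.range fun n => (t n).eval j) (y j)
      then h.choose else 0

variable {R i}

theorem Generated.mem_range_eval {x : ∀ j, R j} (hx : Generated R i x) :
    x ∈ Set.range (ConeTerm.eval R i) := by
  induction hx with
  | of a => exact ⟨.of a, rfl⟩
  | zero => exact ⟨.zero, rfl⟩
  | add _ _ hs ht =>
    obtain ⟨s, rfl⟩ := hs
    obtain ⟨t, rfl⟩ := ht
    exact ⟨.add s t, rfl⟩
  | smul r _ ht =>
    obtain ⟨t, rfl⟩ := ht
    exact ⟨.smul r t, rfl⟩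
  | @sub _ _ z _ _ hz hs ht =>
    obtain ⟨s, rfl⟩ := hs
    obtain ⟨t, rfl⟩ := ht
    refine ⟨.sub s t, ?_⟩
    have h : ∃ z, s.eval R i + z = t.eval R i := ⟨z, hz⟩
    rw [ConeTerm.eval, dif_pos h]
    funext j
    exact add_left_cancel (congrFun (h.choose_spec.trans hz.symm) j)
  | @lub x y _ _ _ hy ht =>
    choose t ht using ht
    refine ⟨.lub t, ?_⟩
    have h : ∃ y : ∀ j, R j, ∀ j, IsLUB (Set.range fun n => (t n).eval R i j) (y j) :=
      ⟨y, by simpa only [ht] using hy⟩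
    rw [ConeTerm.eval, dif_pos h]
    funext j
    refine (h.choose_spec j).unique ?_
    simpa only [ht] using hy j

theorem Generated.bounded {b : A → ℝ≥0} (hb : ∀ a j, ‖i a j‖₊ ≤ b a) {x : ∀ j, R j}
    (hx : Generated R i x) : ∃ C, ∀ j, ‖x j‖₊ ≤ C := by
  induction hx with
  | of a => exact ⟨b a, hb a⟩
  | zero => exact ⟨0, fun j => nnnorm_zero'.le⟩
  | add _ _ hs ht =>
    obtain ⟨C, hC⟩ := hs
    obtain ⟨D, hD⟩ := ht
    exact ⟨C + D, fun j => (nnnorm_add_le' _ _).trans (add_le_add (hC j) (hD j))⟩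
  | smul r _ ht =>
    obtain ⟨C, hC⟩ := ht
    refine ⟨r * C, fun j => (nnnorm_smul' r _).trans_le ?_⟩
    gcongr
    exact hC j
  | sub _ _ hz _ ht =>
    obtain ⟨C, hC⟩ := ht
    refine ⟨C, fun j => (nnnorm_mono ?_).trans (hC j)⟩
    rw [← hz]
    exact le_add_self
  | lub _ hm h1 hy _ => exact ⟨1, fun j => nnnorm_lub_le (hm j) (h1 j) (hy j)⟩

variable (R i)

/-- The subsemimodule of the elements of a generated subcone. -/
def generatedSubmodule : Submodule ℝ≥0 (∀ j, R j) where
  carrier := {x | Generated R i x}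
  add_mem' := .add
  zero_mem' := .zero
  smul_mem' r _ := .smul r

instance : Small.{u} (generatedSubmodule R i) :=
  small_subset (s := Set.range (ConeTerm.eval R i)) (t := generatedSubmodule R i)
    fun _ hx => Generated.mem_range_eval hx

/-- The components of the elements of a generated subcone, which is replaced by a copy in the
universe of its generators. -/
noncomputable def generatedProj (j : J) :
    Shrink.{u} (generatedSubmodule R i) →ₗ[ℝ≥0] R j :=
  LinearMap.proj j ∘ₗ (generatedSubmodule R i).subtype ∘ₗ
    (Shrink.linearEquiv.{u} ℝ≥0 (generatedSubmodule R i)).toLinearMap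

variable {R i}

theorem exists_generatedProj {x : ∀ j, R j} (hx : Generated R i x) :
    ∃ x', ∀ j, generatedProj R i j x' = x j :=
  ⟨(Shrink.linearEquiv.{u} ℝ≥0 (generatedSubmodule R i)).symm ⟨x, hx⟩, fun j => by
    simp [generatedProj]⟩

theorem generated_generatedProj (x : Shrink.{u} (generatedSubmodule R i)) :
    Generated R i fun j => generatedProj R i j x :=
  (Shrink.linearEquiv.{u} ℝ≥0 (generatedSubmodule R i) x).2

theorem generatedProj_ext {x y : Shrink.{u} (generatedSubmodule R i)}
    (h : ∀ j, generatedProj R i j x = generatedProj R i j y) : x = y :=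
  (Shrink.linearEquiv.{u} ℝ≥0 (generatedSubmodule R i)).injective (Subtype.ext (funext h))

theorem pullsBack_generatedProj {b : A → ℝ≥0} (hb : ∀ a j, ‖i a j‖₊ ≤ b a) :
    PullsBack (generatedProj R i) where
  ext _ _ := generatedProj_ext
  bounded x := (generated_generatedProj x).bounded hb
  exists_add x y h := by
    choose z hz using h
    obtain ⟨z', hz'⟩ := exists_generatedProj (Generated.sub (generated_generatedProj x)
      (generated_generatedProj y) (funext hz))
    refine ⟨z', generatedProj_ext fun j => ?_⟩
    rw [map_add, hz', hz]
  exists_lub x hx h1 := by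
    choose y _ hy using fun j => (R j).complete _ (hx j) (h1 j)
    obtain ⟨y', hy'⟩ := exists_generatedProj
      (Generated.lub (fun n => generated_generatedProj (x n)) hx h1 hy)
    exact ⟨y', fun j => by rw [hy']; exact hy j⟩

/-- A class of functions from a set to cones, which is stable under restriction of the target to
subcones of products, has a universal member: all others factor through it by a unique morphism.
The target is the subcone generated by the set of generators in the product of all targets,
and its elements are small in number because each is the value of a formal expression. -/
theorem exists_universal (Φ : ∀ S : SCCLin.{u}, (A → S) → Prop) (b : A → ℝ≥0)
    (hb : ∀ S f, Φ S f → ∀ a, ‖f a‖₊ ≤ b a)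
    (hΦ : ∀ (X : SCCLin.{u}) (J : Type (u + 1)) (S : J → SCCLin.{u}) (π : ∀ j, X ⟶ S j),
      IsInitialFamily π → ∀ f : A → X, (∀ j, Φ (S j) fun a => π j (f a)) → Φ X f) :
    ∃ (X : SCCLin.{u}) (f : A → X), Φ X f ∧
      (∀ S g, Φ S g → ∃ h : X ⟶ S, ∀ a, h (f a) = g a) ∧
      ∀ (S : SCCLin.{u}) (h k : LinMap X.toCompleteCone S.toCompleteCone),
        (∀ a, h (f a) = k (f a)) → h = k := by
  let J : Type (u + 1) := Σ S : SCCLin.{u}, {f : A → S // Φ S f}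
  let R : J → SCCLin.{u} := fun j => j.1
  let i : A → ∀ j, R j := fun a j => j.2.1 a
  have hp : PullsBack (generatedProj R i) := pullsBack_generatedProj fun a j => hb _ _ j.2.2 a
  choose f hf using fun a => exists_generatedProj (Generated.of (R := R) (i := i) a)
  refine ⟨hp.cone, f, hΦ _ J R hp.proj hp.isInitialFamily f fun j => ?_, fun S g hg =>
    ⟨hp.proj ⟨S, g, hg⟩, fun a => hf a ⟨S, g, hg⟩⟩, fun S h k hhk => LinMap.ext fun x => ?_⟩
  · have : (fun a => hp.proj j (f a)) = j.2.1 := funext fun a => hf a j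
    rw [this]
    exact j.2.2
  -- Uniqueness: the elements at which two linear maps agree are closed under all the operations.
  · suffices H : ∀ y, Generated R i y → ∀ x : hp.cone, (∀ j, hp.proj j x = y j) → h x = k x from
      H _ (generated_generatedProj x) x fun j => rfl
    have key : ∀ {y}, Generated R i y → ∃ x : hp.cone, ∀ j, hp.proj j x = y j :=
      fun hy => exists_generatedProj hy
    intro y hy
    induction hy with
    | of a =>
      intro x hx
      rw [hp.isInitialFamily.ext fun j => (hx j).trans (hf a j).symm]
      exact hhk a
    | zero =>
      intro x hx
      rw [hp.isInitialFamily.ext (x := x) (y := 0) fun j =>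
        (hx j).trans ((hp.proj j).toLinMap.map_zero).symm, LinMap.map_zero, LinMap.map_zero]
    | add hs ht ihs iht =>
      intro x hx
      obtain ⟨s, hs⟩ := key hs
      obtain ⟨t, ht⟩ := key ht
      rw [hp.isInitialFamily.ext (x := x) (y := s + t) fun j => by
        refine (hx j).trans (Eq.trans ?_ ((hp.proj j).toLinMap.map_add s t).symm)
        exact congrArg₂ (· + ·) (hs j).symm (ht j).symm, LinMap.map_add, LinMap.map_add,
        ihs s hs, iht t ht]
    | smul r ht iht =>
      intro x hx
      obtain ⟨t, ht⟩ := key ht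
      rw [hp.isInitialFamily.ext (x := x) (y := r • t) fun j => by
        refine (hx j).trans (Eq.trans ?_ ((hp.proj j).toLinMap.map_smul r t).symm)
        exact congrArg (r • ·) (ht j).symm, LinMap.map_smul, LinMap.map_smul, iht t ht]
    | sub hs ht hz ihs iht =>
      intro x hx
      obtain ⟨s, hs⟩ := key hs
      obtain ⟨t, ht⟩ := key ht
      have h1 : s + x = t := hp.isInitialFamily.ext fun j => by
        refine ((hp.proj j).toLinMap.map_add s x).trans (Eq.trans ?_ (ht j).symm)
        rw [← hz]
        exact congrArg₂ (· + ·) (hs j) (hx j)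
      have h2 := iht t ht
      rw [← h1, LinMap.map_add, LinMap.map_add, ihs s hs] at h2
      exact add_left_cancel h2
    | lub hu hm h1 hy ih =>
      intro x hx
      choose t ht using fun n => key (hu n)
      have hmt : Monotone t := fun m n hmn => hp.isInitialFamily.le _ _ fun j => by
        rw [ht, ht]
        exact hm j hmn
      have hnt : ∀ n, ‖t n‖₊ ≤ 1 := fun n => hp.isInitialFamily.nnnorm_le _ _ fun j => by
        rw [ht]
        exact h1 j n
      have hl : IsLUB (Set.range t) x := hp.isInitialFamily.isLUB fun j => by
        simp only [ht, hx]
        exact hy j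
      have h3 := h.continuous' t x hmt hnt hl
      have h4 := k.continuous' t x hmt hnt hl
      refine h3.unique ?_
      have : ∀ n, h.toFun (t n) = k.toFun (t n) := fun n => ih n (t n) (ht n)
      simp only [this]
      exact h4

end Generated

/-! ### Linear maps into function spaces -/

namespace LinMap

variable {P : CompleteCone.{u}} {Q : CompleteCone.{v}} {R : CompleteCone.{w}}

/-- Evaluation at a point. -/
noncomputable def eval (Q : CompleteCone.{v}) (R : CompleteCone.{w}) (y : Q) :
    LinMap (linCone Q R) R where
  toFun h := h y
  map_add' _ _ := rfl
  map_smul' _ _ := rfl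
  continuous' _ _ hu h1 hk := (linCone_isLUB_iff hu h1).1 hk y

theorem le_of_apply_le {f g : linCone Q R} (h : ∀ x, f x ≤ g x) : f ≤ g :=
  exists_sub (f := f) (g := g) h

/-- A map into a space of linear maps is linear and continuous as soon as its composites with
all evaluations are. -/
noncomputable def mkPointwise (F : P → LinMap Q R)
    (hF : ∀ y, ∃ φ : LinMap P R, ∀ x, φ x = F x y) : LinMap P (linCone Q R) where
  toFun := F
  map_add' x x' := LinMap.ext fun y => by
    obtain ⟨φ, hφ⟩ := hF y
    change _ = F x y + F x' y
    rw [← hφ, ← hφ, ← hφ, map_add]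
  map_smul' r x := LinMap.ext fun y => by
    obtain ⟨φ, hφ⟩ := hF y
    change _ = r • F x y
    rw [← hφ, ← hφ, map_smul]
  continuous' x a hx h1 ha := by
    refine isLUB_of_reflects_le (eval Q R) (fun _ _ => le_of_apply_le) fun y => ?_
    obtain ⟨φ, hφ⟩ := hF y
    have := φ.continuous' x a hx h1 ha
    change IsLUB (Set.range fun n => φ (x n)) (φ a) at this
    simp only [hφ] at this
    exact this

end LinMap

/-- Scalar multiplication is continuous in the scalar: the difference between `r • x` and the least
upper bound of the `c n • x` has arbitrarily small norm. -/
theorem isLUB_smul_const {P : CompleteCone.{u}} {c : ℕ → realCone.{v}} {r : realCone.{v}}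
    (hc : Monotone c) (hr : IsLUB (Set.range c) r) (x : P) :
    IsLUB (Set.range fun n => ULift.down (c n) • x) (ULift.down r • x) := by
  have hle : ∀ n, ULift.down (c n) ≤ ULift.down r := fun n => realCone_le.1 (hr.1 ⟨n, rfl⟩)
  have hmono : ∀ {s t : ℝ≥0}, s ≤ t → s • x ≤ t • x := fun {s t} h =>
    ⟨(t - s) • x, by rw [← add_smul, add_tsub_cancel_of_le h]⟩
  obtain ⟨y, -, hy⟩ := exists_lub (ULift.down r * ‖x‖₊)
    (fun m n hmn => hmono (realCone_le.1 (hc hmn)))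
    fun n => by
      rw [nnnorm_smul']
      exact mul_le_mul_left (hle n) _
  suffices h : y = ULift.down r • x from h ▸ hy
  obtain ⟨d, hd⟩ : y ≤ ULift.down r • x := hy.2 (by
    rintro _ ⟨n, rfl⟩
    exact hmono (hle n))
  have hdn : ∀ n, ‖d‖₊ ≤ (ULift.down r - ULift.down (c n)) * ‖x‖₊ := fun n => by
    rw [← nnnorm_smul']
    refine nnnorm_mono (le_of_add_le (z := ULift.down (c n) • x) ?_)
    rw [← add_smul, add_tsub_cancel_of_le (hle n), ← hd]
    exact add_le_add_left (hy.1 ⟨n, rfl⟩) d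
  suffices hd0 : ‖d‖₊ = 0 by rw [← hd, eq_zero_of_nnnorm hd0, add_zero]
  rcases eq_or_ne ‖x‖₊ 0 with hx | hx
  · simpa [hx] using hdn 0
  have hx' := pos_iff_ne_zero.2 hx
  have hle' : ∀ n, ULift.down (c n) ≤ ULift.down r - ‖d‖₊ / ‖x‖₊ := fun n => by
    have := (div_le_iff₀ hx').2 (hdn n)
    exact le_tsub_of_add_le_left ((le_tsub_iff_right (hle n)).1 this)
  have hlub := realCone_le.1 (hr.2 (show (⟨ULift.down r - ‖d‖₊ / ‖x‖₊⟩ : realCone.{v}) ∈ _ by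
    rintro _ ⟨n, rfl⟩
    exact realCone_le.2 (hle' n)))
  have h0 : ‖d‖₊ / ‖x‖₊ ≤ ULift.down r :=
    ((div_le_iff₀ hx').2 (hdn 0)).trans tsub_le_self
  have h1 : ‖d‖₊ / ‖x‖₊ ≤ 0 := by
    have := (le_tsub_iff_right h0).1 hlub
    simpa using this
  simpa [hx] using h1

section Bilinear

variable {P Q R : SCCLin.{u}}

/-- The morphism `P ⟶ (Q ⊸ R)` that corresponds to a bilinear and separately continuous map of
norm at most `1`. Linearity and continuity are expressed by the existence of linear and continuous
maps that agree with `B` in each variable. -/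
noncomputable def mkBilin (B : P → Q → R)
    (hl : ∀ y, ∃ φ : LinMap P.toCompleteCone R.toCompleteCone, ∀ x, φ x = B x y)
    (hr : ∀ x, ∃ φ : LinMap Q.toCompleteCone R.toCompleteCone, ∀ y, φ y = B x y)
    (hb : ∀ x y, ‖x‖₊ ≤ 1 → ‖y‖₊ ≤ 1 → ‖B x y‖₊ ≤ 1) : P ⟶ limpl Q R where
  toLinMap := LinMap.mkPointwise (fun x => (hr x).choose) fun y => by
    obtain ⟨φ, hφ⟩ := hl y
    exact ⟨φ, fun x => (hφ x).trans ((hr x).choose_spec y).symm⟩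
  map_ball x hx := (LinMap.nnnorm_le_iff _ _).2 fun y hy => by
    refine le_trans (le_of_eq ?_) (hb x y hx hy)
    exact congrArg (‖·‖₊) ((hr x).choose_spec y)

@[simp] theorem mkBilin_apply (B : P → Q → R) (hl hr hb) (x : P) (y : Q) :
    (mkBilin B hl hr hb x) y = B x y := (hr x).choose_spec y

theorem limpl_nnnorm_apply_le (h : P ⟶ limpl Q R) (x : P) (y : Q) :
    ‖(h x) y‖₊ ≤ ‖x‖₊ * ‖y‖₊ := by
  refine (LinMap.nnnorm_apply_le (show LinMap Q.toCompleteCone R.toCompleteCone from h x) y).trans ?_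
  gcongr
  refine (LinMap.nnnorm_apply_le h.toLinMap x).trans (mul_le_of_le_one_left' ?_)
  exact (LinMap.nnnorm_le_iff _ _).2 h.map_ball

@[ext] theorem limpl_hom_ext {h k : P ⟶ limpl Q R}
    (hk : ∀ x y, (h x) y = (k x) y) : h = k :=
  hom_ext fun x => LinMap.ext (hk x)

end Bilinear

/-! ### The tensor product -/

section TensorConstruction

/-- The functions on `P × Q` that are bilinear, separately continuous and of norm at most `1`. -/
def IsBilinear (P Q R : SCCLin.{u}) (f : P × Q → R) : Prop :=
  ∃ h : P ⟶ limpl Q R, ∀ x y, f (x, y) = (h x) y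

theorem IsBilinear.of_initial {P Q X : SCCLin.{u}} {J : Type w} {S : J → SCCLin.{u}}
    {π : ∀ j, X ⟶ S j} (hπ : IsInitialFamily π) {f : P × Q → X}
    (hf : ∀ j, IsBilinear P Q (S j) fun a => π j (f a)) : IsBilinear P Q X f := by
  choose h hh using hf
  refine ⟨mkBilin (fun x y => f (x, y)) (fun y => ⟨⟨fun x => f (x, y), fun x x' => ?_,
    fun r x => ?_, fun x a hx h1 ha => ?_⟩, fun _ => rfl⟩) (fun x => ⟨⟨fun y => f (x, y),
    fun y y' => ?_, fun r y => ?_, fun y a hy h1 ha => ?_⟩, fun _ => rfl⟩) fun x y hx hy => ?_,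
    fun x y => (mkBilin_apply (fun x y => f (x, y)) _ _ _ x y).symm⟩
  · refine hπ.ext fun j => ((hh j _ _).trans ?_).trans ((π j).toLinMap.map_add _ _).symm
    exact (DFunLike.congr_fun ((h j).toLinMap.map_add x x') y).trans
      (congrArg₂ (· + ·) (hh j x y).symm (hh j x' y).symm)
  · refine hπ.ext fun j => ((hh j _ _).trans ?_).trans ((π j).toLinMap.map_smul _ _).symm
    exact (DFunLike.congr_fun ((h j).toLinMap.map_smul r x) y).trans
      (congrArg (r • ·) (hh j x y).symm)
  · refine hπ.isLUB fun j => ?_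
    simp only [hh]
    exact ((LinMap.eval _ _ y).comp (h j).toLinMap).continuous' x a hx h1 ha
  · refine hπ.ext fun j => ((hh j _ _).trans ?_).trans ((π j).toLinMap.map_add _ _).symm
    exact (LinMap.map_add _ _ _).trans (congrArg₂ (· + ·) (hh j x y).symm (hh j x y').symm)
  · refine hπ.ext fun j => ((hh j _ _).trans ?_).trans ((π j).toLinMap.map_smul _ _).symm
    exact (LinMap.map_smul _ _ _).trans (congrArg (r • ·) (hh j x y).symm)
  · refine hπ.isLUB fun j => ?_
    simp only [hh]
    exact LinMap.continuous' _ y a hy h1 ha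
  · refine hπ.nnnorm_le _ _ fun j => ?_
    rw [show π j (f (x, y)) = _ from hh j x y]
    exact (limpl_nnnorm_apply_le _ _ _).trans (mul_le_one' hx hy)

theorem exists_tensor (P Q : SCCLin.{u}) : ∃ (X : SCCLin.{u}) (τ : P ⟶ limpl Q X),
    (∀ (S : SCCLin.{u}) (g : P ⟶ limpl Q S), ∃ h : X ⟶ S, ∀ x y,
      h ((τ x) y) = (g x) y) ∧
    ∀ (S : SCCLin.{u}) (h k : LinMap X.toCompleteCone S.toCompleteCone),
      (∀ x y, h ((τ x) y) = k ((τ x) y)) → h = k := by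
  obtain ⟨X, f, ⟨τ, hτ⟩, hl, hu⟩ := exists_universal (IsBilinear P Q) (fun a => ‖a.1‖₊ * ‖a.2‖₊)
    (fun S f ⟨h, hh⟩ ⟨x, y⟩ => by rw [hh]; exact limpl_nnnorm_apply_le h x y)
    (fun X J S π hπ f hf => IsBilinear.of_initial hπ hf)
  refine ⟨X, τ, fun S g => ?_, fun S h k hhk => hu S h k fun ⟨x, y⟩ => by
    rw [hτ]; exact hhk x y⟩
  obtain ⟨h, hh⟩ := hl S (fun a => (g a.1) a.2) ⟨g, fun _ _ => rfl⟩
  exact ⟨h, fun x y => by rw [← hτ]; exact hh (x, y)⟩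

variable (P Q : SCCLin.{u})

/-- The tensor product of two cones, as the universal target of bilinear maps. -/
noncomputable def tens : SCCLin.{u} := (exists_tensor P Q).choose

/-- The universal bilinear map, in curried form. -/
noncomputable def tensHom : P ⟶ limpl Q (tens P Q) := (exists_tensor P Q).choose_spec.choose

variable {P Q}

/-- The linear map `y ↦ x ⊗ y`. -/
noncomputable def tensMap (x : P) : LinMap Q.toCompleteCone (tens P Q).toCompleteCone :=
  tensHom P Q x

/-- The pure tensor `x ⊗ y`. -/
noncomputable def tmk (x : P) (y : Q) : tens P Q := tensMap x y

/-- The linear map `x ↦ x ⊗ y`. -/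
noncomputable def tensMapFlip (y : Q) : LinMap P.toCompleteCone (tens P Q).toCompleteCone :=
  (LinMap.eval _ _ y).comp (tensHom P Q).toLinMap

variable {R : SCCLin.{u}}

theorem nnnorm_tmk_le (x : P) (y : Q) : ‖tmk x y‖₊ ≤ ‖x‖₊ * ‖y‖₊ :=
  limpl_nnnorm_apply_le (tensHom P Q) x y

theorem nnnorm_tmk_le_one {x : P} {y : Q} (hx : ‖x‖₊ ≤ 1) (hy : ‖y‖₊ ≤ 1) : ‖tmk x y‖₊ ≤ 1 :=
  (nnnorm_tmk_le x y).trans (mul_le_one' hx hy)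

/-- The morphism out of the tensor product given by a bilinear map. -/
noncomputable def tensLift (g : P ⟶ limpl Q R) : tens P Q ⟶ R :=
  ((exists_tensor P Q).choose_spec.choose_spec.1 R g).choose

@[simp] theorem tensLift_tmk (g : P ⟶ limpl Q R) (x : P) (y : Q) :
    tensLift g (tmk x y) = (g x) y :=
  ((exists_tensor P Q).choose_spec.choose_spec.1 R g).choose_spec x y

theorem tens_linMap_ext {h k : LinMap (tens P Q).toCompleteCone R.toCompleteCone}
    (H : ∀ x y, h (tmk x y) = k (tmk x y)) : h = k :=
  (exists_tensor P Q).choose_spec.choose_spec.2 R h k H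

theorem coe_toLinMap (f : P ⟶ Q) (x : P) : f.toLinMap x = f x := rfl

theorem toLinMap_injective {f g : P ⟶ Q} (h : f.toLinMap = g.toLinMap) : f = g :=
  hom_ext fun x => DFunLike.congr_fun h x

theorem tens_hom_ext {h k : tens P Q ⟶ R} (H : ∀ x y, h (tmk x y) = k (tmk x y)) : h = k :=
  toLinMap_injective (tens_linMap_ext H)

/-- Morphisms out of a threefold tensor product are determined by their values on pure tensors. -/
theorem tens_hom_ext₃ {S : SCCLin.{u}} {h k : tens (tens P Q) R ⟶ S}
    (H : ∀ x y z, h (tmk (tmk x y) z) = k (tmk (tmk x y) z)) : h = k := by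
  refine tens_hom_ext fun t z => ?_
  have : h.toLinMap.comp (tensMapFlip z) = k.toLinMap.comp (tensMapFlip z) :=
    tens_linMap_ext fun x y => H x y z
  exact DFunLike.congr_fun this t

/-- Morphisms out of a threefold tensor product are determined by their values on pure tensors. -/
theorem tens_hom_ext₃' {S : SCCLin.{u}} {h k : tens P (tens Q R) ⟶ S}
    (H : ∀ x y z, h (tmk x (tmk y z)) = k (tmk x (tmk y z))) : h = k := by
  refine tens_hom_ext fun x t => ?_
  have : h.toLinMap.comp (tensMap x) = k.toLinMap.comp (tensMap x) :=
    tens_linMap_ext fun y z => H x y z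
  exact DFunLike.congr_fun this t

/-- Morphisms out of a fourfold tensor product are determined by their values on pure tensors. -/
theorem tens_hom_ext₄ {S T : SCCLin.{u}} {h k : tens (tens (tens P Q) R) S ⟶ T}
    (H : ∀ x y z w, h (tmk (tmk (tmk x y) z) w) = k (tmk (tmk (tmk x y) z) w)) : h = k := by
  refine tens_hom_ext₃ fun t z w => ?_
  have : h.toLinMap.comp ((tensMapFlip w).comp (tensMapFlip z)) =
      k.toLinMap.comp ((tensMapFlip w).comp (tensMapFlip z)) :=
    tens_linMap_ext fun x y => H x y z w
  exact DFunLike.congr_fun this t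

/-- The tensor product of two morphisms. -/
noncomputable def tensHomMap {P P' Q Q' : SCCLin.{u}} (f : P ⟶ P') (g : Q ⟶ Q') :
    tens P Q ⟶ tens P' Q' :=
  tensLift (f ≫ tensHom P' Q' ≫ limplMap g (𝟙 _))

@[simp] theorem tensHomMap_tmk {P P' Q Q' : SCCLin.{u}} (f : P ⟶ P') (g : Q ⟶ Q') (x : P)
    (y : Q) : tensHomMap f g (tmk x y) = tmk (f x) (g y) :=
  tensLift_tmk _ _ _

variable (P Q R)

/-- The symmetry `x ⊗ y ↦ y ⊗ x`. -/
noncomputable def tensSwap : tens P Q ⟶ tens Q P :=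
  tensLift (mkBilin (fun x y => tmk y x) (fun y => ⟨tensMap y, fun _ => rfl⟩)
    (fun x => ⟨tensMapFlip x, fun _ => rfl⟩) fun _ _ hx hy => nnnorm_tmk_le_one hy hx)

/-- The associativity morphism `(x ⊗ y) ⊗ z ↦ x ⊗ (y ⊗ z)`. -/
noncomputable def tensAssoc : tens (tens P Q) R ⟶ tens P (tens Q R) :=
  tensLift (tensLift (mkBilin (R := limpl R (tens P (tens Q R)))
    (fun x y => (tensMap x).comp (tensMap y))
    (fun y => ⟨LinMap.mkPointwise _ fun z => ⟨tensMapFlip (tmk y z), fun _ => rfl⟩,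
      fun _ => rfl⟩)
    (fun x => ⟨LinMap.mkPointwise _ fun z => ⟨(tensMap x).comp (tensMapFlip z), fun _ => rfl⟩,
      fun _ => rfl⟩)
    fun _ _ hx hy => (LinMap.nnnorm_le_iff _ _).2 fun _ hz =>
      nnnorm_tmk_le_one hx (nnnorm_tmk_le_one hy hz)))

/-- The value of an element of the unit cone. -/
def unitVal (r : unitCone.{u}) : ℝ≥0 := ULift.down r

variable {P} in
/-- The linear and continuous map `r ↦ r x`. -/
noncomputable def unitSmul (x : P) : LinMap unitCone.{u}.toCompleteCone P.toCompleteCone where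
  toFun r := unitVal r • x
  map_add' _ _ := add_smul _ _ _
  map_smul' _ _ := mul_smul _ _ _
  continuous' _ _ hc _ hr := isLUB_smul_const hc hr x

/-- Scalar multiplication `r ⊗ x ↦ r x`. -/
noncomputable def tensUnit : tens unitCone P ⟶ P :=
  tensLift (mkBilin (fun r x => unitVal r • x)
    (fun x => ⟨unitSmul x, fun _ => rfl⟩)
    (fun r => ⟨unitVal r • LinMap.id _, fun _ => rfl⟩)
    fun r x hr hx => by
      rw [nnnorm_smul']
      exact mul_le_one' hr hx)

variable {P Q R}

@[simp] theorem tensSwap_tmk (x : P) (y : Q) : tensSwap P Q (tmk x y) = tmk y x :=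
  (tensLift_tmk _ _ _).trans (mkBilin_apply _ _ _ _ _ _)

@[simp] theorem tensAssoc_tmk (x : P) (y : Q) (z : R) :
    tensAssoc P Q R (tmk (tmk x y) z) = tmk x (tmk y z) := by
  refine (tensLift_tmk _ _ _).trans ?_
  rw [tensLift_tmk]
  exact DFunLike.congr_fun (mkBilin_apply (R := limpl R (tens P (tens Q R))) _ _ _ _ x y) z

@[simp] theorem tensUnit_tmk (r : unitCone.{u}) (x : P) :
    tensUnit P (tmk r x) = unitVal r • x :=
  (tensLift_tmk _ _ _).trans (mkBilin_apply _ _ _ _ _ _)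

/-- The element `1` of the unit cone. -/
def unitOne : unitCone.{u} := ⟨1⟩

@[simp] theorem unitVal_unitOne : unitVal unitOne.{u} = 1 := rfl
theorem unitVal_smul_unitOne (r : unitCone.{u}) : unitVal r • unitOne = r :=
  ULift.ext _ _ (mul_one _)

theorem smul_tmk (r : ℝ≥0) (x : P) (y : Q) : tmk (r • x) y = r • tmk x y :=
  (tensMapFlip y).map_smul r x

theorem tmk_smul (r : ℝ≥0) (x : P) (y : Q) : tmk x (r • y) = r • tmk x y :=
  (tensMap x).map_smul r y

end TensorConstruction

/-! ### The symmetric monoidal structure -/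

theorem tensSwap_tensSwap (P Q : SCCLin.{u}) : tensSwap P Q ≫ tensSwap Q P = 𝟙 _ :=
  tens_hom_ext fun x y => by simp

/-- The symmetry of the tensor product, as an isomorphism. -/
noncomputable def tensBraiding (P Q : SCCLin.{u}) : tens P Q ≅ tens Q P where
  hom := tensSwap P Q
  inv := tensSwap Q P
  hom_inv_id := tensSwap_tensSwap P Q
  inv_hom_id := tensSwap_tensSwap Q P

/-- The inverse `x ⊗ (y ⊗ z) ↦ (x ⊗ y) ⊗ z` of the associativity morphism, obtained from the
associativity morphism by reversing the order of the factors. -/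
noncomputable def tensAssocInv (P Q R : SCCLin.{u}) : tens P (tens Q R) ⟶ tens (tens P Q) R :=
  tensSwap P (tens Q R) ≫ tensHomMap (tensSwap Q R) (𝟙 P) ≫ tensAssoc R Q P ≫
    tensSwap R (tens Q P) ≫ tensHomMap (tensSwap Q P) (𝟙 R)

@[simp] theorem tensAssocInv_tmk {P Q R : SCCLin.{u}} (x : P) (y : Q) (z : R) :
    tensAssocInv P Q R (tmk x (tmk y z)) = tmk (tmk x y) z := by
  simp [tensAssocInv]

/-- The associativity isomorphism. -/
noncomputable def tensAssociator (P Q R : SCCLin.{u}) :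
    tens (tens P Q) R ≅ tens P (tens Q R) where
  hom := tensAssoc P Q R
  inv := tensAssocInv P Q R
  hom_inv_id := tens_hom_ext₃ fun x y z => by simp
  inv_hom_id := tens_hom_ext₃' fun x y z => by simp

/-- The morphism `x ↦ 1 ⊗ x`. -/
noncomputable def tensUnitInv (P : SCCLin.{u}) : P ⟶ tens unitCone P where
  toLinMap := tensMap unitOne
  map_ball _ hx := nnnorm_tmk_le_one (x := unitOne) le_rfl hx

@[simp] theorem tensUnitInv_apply {P : SCCLin.{u}} (x : P) :
    tensUnitInv P x = tmk unitOne x := rfl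

theorem tmk_unitOne {P : SCCLin.{u}} (r : unitCone.{u}) (x : P) :
    tmk unitOne (unitVal r • x) = tmk r x := by
  rw [tmk_smul, ← smul_tmk, unitVal_smul_unitOne]

/-- The isomorphism `1 ⊗ P ≅ P`. -/
noncomputable def tensLeftUnitor (P : SCCLin.{u}) : tens unitCone P ≅ P where
  hom := tensUnit P
  inv := tensUnitInv P
  hom_inv_id := tens_hom_ext fun r x => by simp [tmk_unitOne]
  inv_hom_id := hom_ext fun x => by simp

theorem hom_map_smul {P Q : SCCLin.{u}} (f : P ⟶ Q) (r : ℝ≥0) (x : P) : f (r • x) = r • f x :=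
  f.toLinMap.map_smul r x

section Coherence

variable {P P₁ P₂ P₃ Q Q₁ Q₂ Q₃ R R₁ R₂ : SCCLin.{u}}

theorem tensHomMap_eq_comp (f : P₁ ⟶ P₂) (g : Q₁ ⟶ Q₂) :
    tensHomMap f g = tensHomMap f (𝟙 Q₁) ≫ tensHomMap (𝟙 P₂) g :=
  tens_hom_ext fun x y => by simp

theorem tensHomMap_id : tensHomMap (𝟙 P) (𝟙 Q) = 𝟙 (tens P Q) :=
  tens_hom_ext fun x y => by simp

theorem tensHomMap_comp (f : P₁ ⟶ P₂) (g : Q₁ ⟶ Q₂) (f' : P₂ ⟶ P₃) (g' : Q₂ ⟶ Q₃) :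
    tensHomMap f g ≫ tensHomMap f' g' = tensHomMap (f ≫ f') (g ≫ g') :=
  tens_hom_ext fun x y => by simp

theorem tensAssoc_naturality (f : P₁ ⟶ P₂) (g : Q₁ ⟶ Q₂) (h : R₁ ⟶ R₂) :
    tensHomMap (tensHomMap f g) h ≫ tensAssoc P₂ Q₂ R₂ =
      tensAssoc P₁ Q₁ R₁ ≫ tensHomMap f (tensHomMap g h) :=
  tens_hom_ext₃ fun x y z => by simp

theorem tensUnit_naturality (f : P ⟶ Q) :
    tensHomMap (𝟙 unitCone) f ≫ tensUnit Q = tensUnit P ≫ f :=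
  tens_hom_ext fun r x => by simp [hom_map_smul]

theorem tensSwap_naturality (f : P₁ ⟶ P₂) (g : Q₁ ⟶ Q₂) :
    tensHomMap f g ≫ tensSwap P₂ Q₂ = tensSwap P₁ Q₁ ≫ tensHomMap g f :=
  tens_hom_ext fun x y => by simp

theorem tens_pentagon (P Q R S : SCCLin.{u}) :
    tensHomMap (tensAssoc P Q R) (𝟙 S) ≫ tensAssoc P (tens Q R) S ≫
        tensHomMap (𝟙 P) (tensAssoc Q R S) =
      tensAssoc (tens P Q) R S ≫ tensAssoc P Q (tens R S) :=
  tens_hom_ext₄ fun x y z w => by simp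

theorem tens_triangle (P Q : SCCLin.{u}) :
    tensAssoc P unitCone Q ≫ tensHomMap (𝟙 P) (tensUnit Q) =
      tensHomMap (tensSwap P unitCone ≫ tensUnit P) (𝟙 Q) :=
  tens_hom_ext₃ fun x r y => by simp [smul_tmk, tmk_smul]

theorem tens_hexagon (P Q R : SCCLin.{u}) :
    tensAssoc P Q R ≫ tensSwap P (tens Q R) ≫ tensAssoc Q R P =
      tensHomMap (tensSwap P Q) (𝟙 R) ≫ tensAssoc Q P R ≫ tensHomMap (𝟙 Q) (tensSwap P R) :=
  tens_hom_ext₃ fun x y z => by simp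

theorem tens_hexagon' (P Q R : SCCLin.{u}) :
    tensAssocInv P Q R ≫ tensSwap (tens P Q) R ≫ tensAssocInv R P Q =
      tensHomMap (𝟙 P) (tensSwap Q R) ≫ tensAssocInv P R Q ≫ tensHomMap (tensSwap P R) (𝟙 Q) :=
  tens_hom_ext₃' fun x y z => by simp

end Coherence

/-- The monoidal structure given by the tensor product of cones. -/
noncomputable abbrev tensorMonoidal : MonoidalCategory SCCLin.{u} where
  tensorObj := tens
  tensorHom := tensHomMap
  whiskerLeft P _ _ g := tensHomMap (𝟙 P) g
  whiskerRight f Q := tensHomMap f (𝟙 Q)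
  tensorUnit := unitCone
  associator := tensAssociator
  leftUnitor := tensLeftUnitor
  rightUnitor P := tensBraiding P unitCone ≪≫ tensLeftUnitor P
  tensorHom_def := tensHomMap_eq_comp
  id_tensorHom_id _ _ := tensHomMap_id
  tensorHom_comp_tensorHom := tensHomMap_comp
  whiskerLeft_id _ _ := tensHomMap_id
  id_whiskerRight _ _ := tensHomMap_id
  associator_naturality := tensAssoc_naturality
  leftUnitor_naturality := tensUnit_naturality
  rightUnitor_naturality {P Q} f := by
    change tensHomMap f (𝟙 unitCone) ≫ tensSwap Q unitCone ≫ tensUnit Q =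
      (tensSwap P unitCone ≫ tensUnit P) ≫ f
    rw [← Category.assoc, tensSwap_naturality, Category.assoc, tensUnit_naturality, Category.assoc]
  pentagon := tens_pentagon
  triangle := tens_triangle

section

attribute [local instance] tensorMonoidal

/-- The symmetry `x ⊗ y ↦ y ⊗ x` of the tensor product of cones. -/
noncomputable abbrev tensorSymmetric : SymmetricCategory SCCLin.{u} where
  braiding := tensBraiding
  braiding_naturality_right P _ _ f := tensSwap_naturality (𝟙 P) f
  braiding_naturality_left f P := tensSwap_naturality f (𝟙 P)
  hexagon_forward := tens_hexagon
  hexagon_reverse := tens_hexagon'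
  symmetry := tensSwap_tensSwap

attribute [local instance] tensorSymmetric

/-- The correspondence between morphisms out of the tensor product and morphisms into the linear
function space. -/
noncomputable def tensCurryEquiv (P Q R : SCCLin.{u}) : (tens P Q ⟶ R) ≃ (P ⟶ limpl Q R) where
  toFun f := tensHom P Q ≫ limplMap (𝟙 Q) f
  invFun := tensLift
  left_inv _ := tens_hom_ext fun _ _ => tensLift_tmk _ _ _
  right_inv _ := limpl_hom_ext fun _ _ => tensLift_tmk _ _ _

theorem tensLift_comp_left {P P' Q R : SCCLin.{u}} (f : P ⟶ P') (g : P' ⟶ limpl Q R) :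
    tensLift (f ≫ g) = tensHomMap f (𝟙 Q) ≫ tensLift g :=
  tens_hom_ext fun x y => by simp

theorem tensCurryEquiv_comp_right {P Q Q' R : SCCLin.{u}} (f : Q ⟶ Q') (g : tens P Q' ⟶ R) :
    tensCurryEquiv P Q R (tensHomMap (𝟙 P) f ≫ g) =
      tensCurryEquiv P Q' R g ≫ limplMap f (𝟙 R) :=
  limpl_hom_ext fun x y => congrArg g (tensHomMap_tmk (𝟙 P) f x y)

/-- The adjunction between the tensor product and the linear function space. -/
noncomputable def tensorAdj : (curriedTensor SCCLin.{u}).flip ⊣₂ limplFunctor :=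
  ParametrizedAdjunction.mk'
    (fun Q => Adjunction.mkOfHomEquiv
      { homEquiv := fun P R => tensCurryEquiv P Q R
        homEquiv_naturality_left_symm := tensLift_comp_left
        homEquiv_naturality_right := fun _ _ => limpl_hom_ext fun _ _ => rfl })
    (fun f _ _ g => tensCurryEquiv_comp_right f g)

theorem pureTensor_tensorAdj {P Q : SCCLin.{u}} (x : P) (y : Q) :
    pureTensor tensorAdj x y = tmk x y := rfl

/-- The tensor product of cones. -/
noncomputable def coneTensor : ConeTensor.{u} where
  adj := tensorAdj
  unitIso := Iso.refl _
  associator_pure x y z := by simp only [pureTensor_tensorAdj]; exact tensAssoc_tmk x y z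
  leftUnitor_pure r x := by
    simp only [pureTensor_tensorAdj]; exact tensUnit_tmk _ x
  rightUnitor_pure x r := by
    simp only [pureTensor_tensorAdj]
    refine (congrArg (tensUnit _) (tensSwap_tmk _ _)).trans (tensUnit_tmk _ x)
  braiding_pure x y := by simp only [pureTensor_tensorAdj]; exact tensSwap_tmk x y

end

/-! ### Stable functions -/

section Stable

variable {P Q R : CompleteCone.{u}}

theorem LinMap.map_sum (f : LinMap P Q) {ι : Type*} (s : Finset ι) (g : ι → P) :
    f (∑ i ∈ s, g i) = ∑ i ∈ s, f (g i) :=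
  _root_.map_sum (⟨⟨f, f.map_zero⟩, f.map_add⟩ : P →+ Q) g s

theorem LinMap.map_oddSum (f : LinMap P Q) {ι : Type*} (S : Finset ι) (F : Finset ι → P) :
    f (oddSum S F) = oddSum S fun I => f (F I) := f.map_sum _ _

theorem LinMap.map_evenSum (f : LinMap P Q) {ι : Type*} (S : Finset ι) (F : Finset ι → P) :
    f (evenSum S F) = evenSum S fun I => f (F I) := f.map_sum _ _

theorem IsStable.linMap_comp (φ : LinMap Q R) {f : Ball P.toPosCone → Q} (hf : IsStable f) :
    IsStable fun x => φ (f x) where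
  bounded := by
    obtain ⟨C, hC⟩ := hf.bounded
    refine ⟨‖φ‖₊ * C, fun x => (φ.nnnorm_apply_le _).trans ?_⟩
    gcongr
    exact hC x
  totallyMonotone n x h := by
    rw [← φ.map_oddSum, ← φ.map_evenSum]
    exact φ.mono (hf.totallyMonotone n x h)
  continuous x y hx hy := by
    obtain ⟨C, hC⟩ := hf.bounded
    exact φ.continuous_of_bdd C (fun _ _ hmn => hf.mono (hx hmn)) (fun n => hC _)
      (hf.continuous x y hx hy)

theorem IsStable.of_initial {P X : SCCLin.{u}} {J : Type w} {S : J → SCCLin.{u}}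
    {π : ∀ j, X ⟶ S j} (hπ : IsInitialFamily π) {f : Ball P.toPosCone → X} {C : ℝ≥0}
    (hC : ∀ x, ‖f x‖₊ ≤ C) (hf : ∀ j, IsStable fun x => π j (f x)) : IsStable f where
  bounded := ⟨C, hC⟩
  totallyMonotone n x h := hπ.le _ _ fun j => by
    have h1 := (π j).toLinMap.map_oddSum Finset.univ fun I => f (ballSum x h I)
    have h2 := (π j).toLinMap.map_evenSum Finset.univ fun I => f (ballSum x h I)
    exact h1.trans_le (((hf j).totallyMonotone n x h).trans h2.ge)
  continuous x y hx hy := hπ.isLUB fun j => (hf j).continuous x y hx hy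

theorem IsStable.const (c : Q) : IsStable fun _ : Ball P.toPosCone => c where
  bounded := ⟨‖c‖₊, fun _ => le_rfl⟩
  totallyMonotone n x h := totallyMonotone_of_decomposition (h := h) (f := fun _ : Ball P.toPosCone => c)
    (fun J => if J = ∅ then c else 0) fun I => by simp
  continuous x y _ _ := by simp [isLUB_singleton]

theorem IsStable.add {f g : Ball P.toPosCone → Q} (hf : IsStable f) (hg : IsStable g) :
    IsStable fun x => f x + g x where
  bounded := by
    obtain ⟨C, hC⟩ := hf.bounded
    obtain ⟨D, hD⟩ := hg.bounded
    exact ⟨C + D, fun x => (nnnorm_add_le' _ _).trans (add_le_add (hC x) (hD x))⟩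
  totallyMonotone n x h := by
    rw [oddSum_add, evenSum_add]
    exact add_le_add (hf.totallyMonotone n x h) (hg.totallyMonotone n x h)
  continuous x y hx hy := isLUB_add (fun _ _ hmn => hf.mono (hx hmn))
    (fun _ _ hmn => hg.mono (hx hmn)) (hf.continuous x y hx hy) (hg.continuous x y hx hy)

theorem IsStable.sum {ι : Type*} {s : Finset ι} {f : ι → Ball P.toPosCone → Q}
    (hf : ∀ i, IsStable (f i)) : IsStable fun x => ∑ i ∈ s, f i x := by
  classical
  induction s using Finset.induction_on with
  | empty =>
    simp only [Finset.sum_empty]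
    exact IsStable.const 0
  | insert a s ha ih =>
    simp only [Finset.sum_insert ha]
    exact (hf a).add ih

/-- The element `(f x, g x)` of the product of two cones. -/
def pairFun (f : Ball P.toPosCone → Q) (g : Ball P.toPosCone → R) (x : Ball P.toPosCone) :
    withCone Q R := (f x, g x)

theorem IsStable.pair {f : Ball P.toPosCone → Q} {g : Ball P.toPosCone → R} (hf : IsStable f)
    (hg : IsStable g) : IsStable (pairFun f g) where
  bounded := by
    obtain ⟨C, hC⟩ := hf.bounded
    obtain ⟨D, hD⟩ := hg.bounded
    exact ⟨max C D, fun x => max_le_max (hC x) (hD x)⟩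
  totallyMonotone n x h := by
    refine with_le_iff.2 ⟨?_, ?_⟩
    · have h1 := (fstMap Q R).map_oddSum Finset.univ fun I => pairFun f g (ballSum x h I)
      have h2 := (fstMap Q R).map_evenSum Finset.univ fun I => pairFun f g (ballSum x h I)
      exact h1.trans_le ((hf.totallyMonotone n x h).trans h2.ge)
    · have h1 := (sndMap Q R).map_oddSum Finset.univ fun I => pairFun f g (ballSum x h I)
      have h2 := (sndMap Q R).map_evenSum Finset.univ fun I => pairFun f g (ballSum x h I)
      exact h1.trans_le ((hg.totallyMonotone n x h).trans h2.ge)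
  continuous x y hx hy := with_isLUB_iff.2 ⟨hf.continuous x y hx hy, hg.continuous x y hx hy⟩

/-- Total monotonicity for families of length at most `2` implies monotonicity. -/
theorem monotone_of_totallyMonotone {f : Ball P.toPosCone → Q}
    (hf : ∀ (n : ℕ) (x : Fin n → P) (h : ‖∑ i, x i‖₊ ≤ 1),
      oddSum Finset.univ (fun I => f (ballSum x h I)) ≤
        evenSum Finset.univ (fun I => f (ballSum x h I))) : Monotone f := by
  rintro ⟨x, hx⟩ ⟨y, hy⟩ ⟨z, hz⟩
  obtain rfl : x + z = y := hz
  have hz1 : ‖z‖₊ ≤ 1 := (nnnorm_mono le_add_self).trans hy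
  have h0 : ‖(0 : P)‖₊ ≤ 1 := nnnorm_zero'.trans_le zero_le
  -- The cases `f 0 ≤ f z` and `f x + f z ≤ f 0 + f (x + z)` add up to `f x ≤ f (x + z)`.
  have h1 := hf 1 ![z] (by simpa using hz1)
  have h2 := hf 2 ![x, z] (by simpa using hy)
  have u1 : (Finset.univ : Finset (Fin 1)) = insert 0 ∅ := rfl
  have u2 : (Finset.univ : Finset (Fin 2)) = insert 0 (insert 1 ∅) := rfl
  have o1 : ∀ F : Finset (Fin 1) → Q, oddSum Finset.univ F = F ∅ := fun F => by
    rw [u1, oddSum_insert (by simp)]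
    simp [oddSum, evenSum]
  have e1 : ∀ F : Finset (Fin 1) → Q, evenSum Finset.univ F = F {0} := fun F => by
    rw [u1, evenSum_insert (by simp)]
    simp [oddSum, evenSum]
  have o2 : ∀ F : Finset (Fin 2) → Q, oddSum Finset.univ F = F {1} + F {0} := fun F => by
    rw [u2, oddSum_insert (by simp), oddSum_insert (by simp), evenSum_insert (by simp)]
    simp [oddSum, evenSum]
  have e2 : ∀ F : Finset (Fin 2) → Q, evenSum Finset.univ F = F ∅ + F {0, 1} := fun F => by
    rw [u2, evenSum_insert (by simp), oddSum_insert (by simp), evenSum_insert (by simp)]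
    simp [oddSum, evenSum]
  rw [o1, e1] at h1
  rw [o2, e2] at h2
  have h1' : f ⟨0, h0⟩ ≤ f ⟨z, hz1⟩ := by
    convert h1 using 1
    · rfl
    · exact congrArg f (Subtype.ext (Finset.sum_singleton _ _).symm)
  have h2' : f ⟨z, hz1⟩ + f ⟨x, hx⟩ ≤ f ⟨0, h0⟩ + f ⟨x + z, hy⟩ := by
    convert h2 using 2
    · exact congrArg f (Subtype.ext (Finset.sum_singleton _ _).symm)
    · exact congrArg f (Subtype.ext (Finset.sum_singleton _ _).symm)
    · rfl
    · exact congrArg f (Subtype.ext (Finset.sum_pair (f := ![x, z]) Fin.zero_ne_one).symm)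
  refine le_of_add_le (z := f ⟨0, h0⟩) (le_trans ?_ h2')
  exact add_le_add_left h1' _

end Stable

/-- The universal bilinear map is stable. -/
theorem isStable_tmk (P Q : SCCLin.{u}) :
    IsStable (fun v : Ball (withObj P Q).toPosCone => tmk v.1.1 v.1.2) where
  bounded := ⟨1, fun v =>
    nnnorm_tmk_le_one ((le_max_left _ _).trans v.2) ((le_max_right _ _).trans v.2)⟩
  totallyMonotone n v h := by
    -- The pair `(i, j)` contributes to the value at a partial sum exactly if both `i` and `j` occur.
    refine totallyMonotone_of_decomposition
      (f := fun v : Ball (withObj P Q).toPosCone => tmk v.1.1 v.1.2)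
      (fun J => ∑ ij : Fin n × Fin n with J = {ij.1, ij.2}, tmk (v ij.1).1 (v ij.2).2)
      fun I => ?_
    have h1 : (ballSum v h I).1.1 = ∑ i ∈ I, (v i).1 :=
      (fstMap P.toCompleteCone Q.toCompleteCone).map_sum I v
    have h2 : (ballSum v h I).1.2 = ∑ i ∈ I, (v i).2 :=
      (sndMap P.toCompleteCone Q.toCompleteCone).map_sum I v
    have h3 : tmk (∑ i ∈ I, (v i).1) (∑ j ∈ I, (v j).2) =
        ∑ i ∈ I, ∑ j ∈ I, tmk (v i).1 (v j).2 := by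
      refine ((tensMapFlip _).map_sum I _).trans (Finset.sum_congr rfl fun i _ => ?_)
      exact (tensMap _).map_sum I _
    rw [h1, h2, h3, ← Finset.sum_product']
    simp only [Finset.sum_filter]
    rw [Finset.sum_comm]
    simp only [Finset.sum_ite_eq', Finset.mem_powerset]
    rw [← Finset.sum_filter]
    refine Finset.sum_congr ?_ fun _ _ => rfl
    ext ij
    simp [Finset.insert_subset_iff]
  continuous v a hv ha := by
    obtain ⟨h1, h2⟩ := with_isLUB_iff.1 ha
    have hv1 : Monotone fun n => (v n).1.1 := fun m n hmn => (with_le_iff.1 (hv hmn)).1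
    have hv2 : Monotone fun n => (v n).1.2 := fun m n hmn => (with_le_iff.1 (hv hmn)).2
    have hmono : ∀ {x x' : P} {y y' : Q}, x ≤ x' → y ≤ y' → tmk x y ≤ tmk x' y' :=
      fun hx hy => ((tensMapFlip _).mono hx).trans ((tensMap _).mono hy)
    refine ⟨?_, fun z hz => ?_⟩
    · rintro _ ⟨n, rfl⟩
      exact hmono (h1.1 ⟨n, rfl⟩) (h2.1 ⟨n, rfl⟩)
    · refine ((tensMapFlip _).continuous' _ _ hv1
        (fun n => (le_max_left _ _).trans (v n).2) h1).2 ?_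
      rintro _ ⟨n, rfl⟩
      refine ((tensMap _).continuous' _ _ hv2
        (fun n => (le_max_right _ _).trans (v n).2) h2).2 ?_
      rintro _ ⟨m, rfl⟩
      exact (hmono (hv1 (le_max_left n m)) (hv2 (le_max_right n m))).trans (hz ⟨max n m, rfl⟩)

/-! ### Universal stable maps -/

/-- A stable map `p : P → X` between unit balls such that every stable map out of `P` extends
along `p` to a unique morphism out of `X`; uniqueness is stated for linear and continuous maps of
arbitrary norm. -/
structure IsUniversalStable {P X : SCCLin.{u}} (p : Ball P.toPosCone → Ball X.toPosCone) :
    Prop where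
  isStable : IsStable fun x => (p x).1
  exists_lift : ∀ {S : SCCLin.{u}} (f : Ball P.toPosCone → S), IsStable f → (∀ x, ‖f x‖₊ ≤ 1) →
    ∃ h : X ⟶ S, ∀ x, h (p x).1 = f x
  linMap_ext : ∀ {S : SCCLin.{u}} (h k : LinMap X.toCompleteCone S.toCompleteCone),
    (∀ x, h (p x).1 = k (p x).1) → h = k

theorem exists_isUniversalStable (P : SCCLin.{u}) :
    ∃ (X : SCCLin.{u}) (p : Ball P.toPosCone → Ball X.toPosCone), IsUniversalStable p := by
  obtain ⟨X, p, ⟨hp, hp1⟩, hl, hu⟩ := exists_universal (A := Ball P.toPosCone)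
    (fun S f => IsStable (Q := S.toCompleteCone) f ∧ ∀ x, ‖f x‖₊ ≤ 1) (fun _ => 1)
    (fun _ _ hf => hf.2) fun X J S π hπ f hf =>
      have h1 : ∀ x, ‖f x‖₊ ≤ 1 := fun x => hπ.nnnorm_le _ _ fun j => (hf j).2 x
      ⟨IsStable.of_initial hπ h1 fun j => (hf j).1, h1⟩
  exact ⟨X, fun x => ⟨p x, hp1 x⟩, hp, fun f hf h1 => hl _ f ⟨hf, h1⟩, fun h k => hu _ h k⟩

namespace IsUniversalStable

variable {P Q X Y S : SCCLin.{u}} {p : Ball P.toPosCone → Ball X.toPosCone}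
  {q : Ball Q.toPosCone → Ball Y.toPosCone}

theorem hom_ext (hp : IsUniversalStable p) {h k : X ⟶ S} (H : ∀ x, h (p x).1 = k (p x).1) :
    h = k :=
  toLinMap_injective (hp.linMap_ext h.toLinMap k.toLinMap H)

/-- Stable functions of arbitrary norm extend to linear and continuous maps. -/
theorem exists_linMap (hp : IsUniversalStable p) {f : Ball P.toPosCone → S} (hf : IsStable f) :
    ∃ h : LinMap X.toCompleteCone S.toCompleteCone, ∀ x, h (p x).1 = f x := by
  obtain ⟨C, hC⟩ := hf.bounded
  have hC0 : C + 1 ≠ 0 := by positivity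
  obtain ⟨h, hh⟩ := hp.exists_lift (fun x => (C + 1)⁻¹ • f x)
    (hf.linMap_comp ((C + 1)⁻¹ • LinMap.id S.toCompleteCone)) fun x => by
      rw [nnnorm_smul', inv_mul_le_iff₀ (pos_iff_ne_zero.2 hC0), mul_one]
      exact (hC x).trans le_self_add
  refine ⟨(C + 1) • h.toLinMap, fun x => ?_⟩
  rw [LinMap.smul_apply, coe_toLinMap, hh, smul_smul, mul_inv_cancel₀ hC0, one_smul]

/-- Universal stable maps out of the same cone have isomorphic targets. -/
noncomputable def iso {X' : SCCLin.{u}} {p' : Ball P.toPosCone → Ball X'.toPosCone}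
    (hp : IsUniversalStable p) (hp' : IsUniversalStable p') : X ≅ X' where
  hom := (hp.exists_lift _ hp'.isStable fun x => (p' x).2).choose
  inv := (hp'.exists_lift _ hp.isStable fun x => (p x).2).choose
  hom_inv_id := hp.hom_ext fun x => by
    rw [comp_apply', (hp.exists_lift _ hp'.isStable fun x => (p' x).2).choose_spec,
      (hp'.exists_lift _ hp.isStable fun x => (p x).2).choose_spec, id_apply']
  inv_hom_id := hp'.hom_ext fun x => by
    rw [comp_apply', (hp'.exists_lift _ hp.isStable fun x => (p x).2).choose_spec,
      (hp.exists_lift _ hp'.isStable fun x => (p' x).2).choose_spec, id_apply']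

@[simp] theorem iso_hom_apply {X' : SCCLin.{u}} {p' : Ball P.toPosCone → Ball X'.toPosCone}
    (hp : IsUniversalStable p) (hp' : IsUniversalStable p') (x : Ball P.toPosCone) :
    (hp.iso hp').hom (p x).1 = (p' x).1 :=
  (hp.exists_lift _ hp'.isStable fun x => (p' x).2).choose_spec x

end IsUniversalStable

/-! ### Stable functions of two variables -/

section TwoVariables

variable {P Q X Y S : SCCLin.{u}}

/-- On partial sums of two finite families, a stable function of two variables is a sum of
contributions of pairs of subfamilies. -/
theorem exists_decomposition₂ {f : Ball (withObj P Q).toPosCone → S} (hf : IsStable f)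
    {n m : ℕ} (x : Fin n → P) (hx : ‖∑ i, x i‖₊ ≤ 1) (y : Fin m → Q) (hy : ‖∑ i, y i‖₊ ≤ 1) :
    ∃ d : Finset (Fin n) → Finset (Fin m) → S, ∀ I K,
      f (ballPair (ballSum x hx I) (ballSum y hy K)) =
        ∑ A ∈ I.powerset, ∑ B ∈ K.powerset, d A B := by
  -- The two families form a single family `(x i, 0)`, `(0, y j)` in the product.
  let v : Fin n ⊕ Fin m → withObj P Q := Sum.elim (fun i => (x i, 0)) (fun j => (0, y j))
  have hv : ∀ (I : Finset (Fin n)) (K : Finset (Fin m)), ∑ s ∈ I.disjSum K, v s =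
      (ballPair (ballSum x hx I) (ballSum y hy K)).1 := by
    intro I K
    have h1 := (fstMap P.toCompleteCone Q.toCompleteCone).map_sum (I.disjSum K) v
    have h2 := (sndMap P.toCompleteCone Q.toCompleteCone).map_sum (I.disjSum K) v
    rw [Finset.sum_disjSum] at h1 h2
    refine Prod.ext (h1.trans ?_) (h2.trans ?_)
    · have : ∑ j ∈ K, fstMap P.toCompleteCone Q.toCompleteCone (v (Sum.inr j)) = 0 :=
        Finset.sum_eq_zero fun _ _ => rfl
      rw [this, add_zero]
      rfl
    · have : ∑ i ∈ I, sndMap P.toCompleteCone Q.toCompleteCone (v (Sum.inl i)) = 0 :=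
        Finset.sum_eq_zero fun _ _ => rfl
      rw [this, zero_add]
      rfl
  obtain ⟨d, hd⟩ := hf.exists_decomposition v (by
    rw [← Finset.univ_disjSum_univ, hv]
    exact (ballPair _ _).2)
  refine ⟨fun A B => d (A.disjSum B), fun I K => ?_⟩
  have h := hd (I.disjSum K)
  rw [hv, ballExtend_of_le f (ballPair _ _).2] at h
  refine h.trans ?_
  rw [← Finset.sum_product']
  refine Finset.sum_nbij' (fun T => (T.toLeft, T.toRight)) (fun AB => AB.1.disjSum AB.2)
    ?_ ?_ ?_ ?_ ?_
  · intro T hT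
    rw [Finset.mem_powerset] at hT
    rw [Finset.mem_product, Finset.mem_powerset, Finset.mem_powerset]
    exact ⟨by simpa using Finset.toLeft_subset_toLeft hT,
      by simpa using Finset.toRight_subset_toRight hT⟩
  · rintro ⟨A, B⟩ hAB
    rw [Finset.mem_product, Finset.mem_powerset, Finset.mem_powerset] at hAB
    exact Finset.mem_powerset.2 (Finset.disjSum_mono hAB.1 hAB.2)
  · exact fun T _ => Finset.toLeft_disjSum_toRight
  · intro AB _
    simp
  · exact fun T _ => congrArg d Finset.toLeft_disjSum_toRight.symm

theorem isStable_ballPair_left {f : Ball (withObj P Q).toPosCone → S} (hf : IsStable f)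
    (x : Ball P.toPosCone) : IsStable fun y : Ball Q.toPosCone => f (ballPair x y) :=
  hf.comp (f := ballPair x) (IsStable.pair (IsStable.const x.1)
    (LinMap.id Q.toCompleteCone).isStable)

theorem isStable_ballPair_right {f : Ball (withObj P Q).toPosCone → S} (hf : IsStable f)
    (y : Ball Q.toPosCone) : IsStable fun x : Ball P.toPosCone => f (ballPair x y) :=
  hf.comp (f := fun x => ballPair x y) (IsStable.pair (LinMap.id P.toCompleteCone).isStable
    (IsStable.const y.1))

/-- The alternating difference of a stable function of two variables with respect to the first
variable is stable in the second variable. -/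
theorem exists_isStable_difference {f : Ball (withObj P Q).toPosCone → S} (hf : IsStable f)
    {n : ℕ} (x : Fin n → P) (hx : ‖∑ i, x i‖₊ ≤ 1) :
    ∃ d : Ball Q.toPosCone → S, IsStable d ∧ ∀ y,
      oddSum Finset.univ (fun I => f (ballPair (ballSum x hx I) y)) + d y =
        evenSum Finset.univ (fun I => f (ballPair (ballSum x hx I) y)) := by
  have key : ∀ (m : ℕ) (y : Fin m → Q) (hy : ‖∑ i, y i‖₊ ≤ 1), ∃ d : Finset (Fin m) → S, ∀ K,
      oddSum Finset.univ (fun I => f (ballPair (ballSum x hx I) (ballSum y hy K))) +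
        ∑ B ∈ K.powerset, d B =
      evenSum Finset.univ (fun I => f (ballPair (ballSum x hx I) (ballSum y hy K))) := by
    intro m y hy
    obtain ⟨d, hd⟩ := exists_decomposition₂ hf x hx y hy
    refine ⟨d Finset.univ, fun K => ?_⟩
    simp only [hd]
    exact oddSum_add_eq_evenSum Finset.univ fun A => ∑ B ∈ K.powerset, d A B
  have hex : ∀ y : Ball Q.toPosCone, ∃ d : S,
      oddSum Finset.univ (fun I => f (ballPair (ballSum x hx I) y)) + d =
        evenSum Finset.univ (fun I => f (ballPair (ballSum x hx I) y)) := by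
    intro y
    have hy : ‖∑ i : Fin 1, (fun _ => y.1) i‖₊ ≤ 1 := by
      simpa using y.2
    obtain ⟨d, hd⟩ := key 1 (fun _ => y.1) hy
    have : ballSum (fun _ : Fin 1 => y.1) hy Finset.univ = y :=
      Subtype.ext (Fin.sum_univ_one fun _ : Fin 1 => y.1)
    have h := hd Finset.univ
    rw [this] at h
    exact ⟨_, h⟩
  choose d hd using hex
  have htot : ∀ (m : ℕ) (y : Fin m → Q) (hy : ‖∑ i, y i‖₊ ≤ 1),
      oddSum Finset.univ (fun K => d (ballSum y hy K)) ≤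
        evenSum Finset.univ (fun K => d (ballSum y hy K)) := by
    intro m y hy
    obtain ⟨e, he⟩ := key m y hy
    exact totallyMonotone_of_decomposition e fun K =>
      add_left_cancel ((hd _).trans (he K).symm)
  -- Continuity: `d` is a monotone difference of two stable functions.
  have hle : ∀ y, d y ≤ evenSum Finset.univ (fun I => f (ballPair (ballSum x hx I) y)) :=
    fun y => ⟨_, (add_comm _ _).trans (hd y)⟩
  have hodd : IsStable fun y => oddSum Finset.univ (fun I => f (ballPair (ballSum x hx I) y)) :=
    IsStable.sum fun I => isStable_ballPair_left hf _
  have heven : IsStable fun y => evenSum Finset.univ (fun I => f (ballPair (ballSum x hx I) y)) :=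
    IsStable.sum fun I => isStable_ballPair_left hf _
  have hmono := monotone_of_totallyMonotone htot
  refine ⟨d, ⟨heven.bounded.imp fun C hC y => (nnnorm_mono (hle y)).trans (hC y), htot,
    fun y b hy hb => ⟨?_, fun z hz => ?_⟩⟩, hd⟩
  · rintro _ ⟨n, rfl⟩
    exact hmono (show (y n).1 ≤ b.1 from hb.1 ⟨n, rfl⟩)
  · refine le_of_add_le
      (z := oddSum Finset.univ (fun I => f (ballPair (ballSum x hx I) b))) ?_
    rw [hd]
    refine (heven.continuous y b hy hb).2 ?_
    rintro _ ⟨n, rfl⟩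
    dsimp only
    rw [← hd]
    exact add_le_add ((hodd.continuous y b hy hb).1 ⟨n, rfl⟩) (hz ⟨n, rfl⟩)

/-- Currying for universal stable maps: a stable function on `P & Q` of norm at most `1` factors
through the tensor product of the targets. The curried function, with values in `Y ⊸ S`, is totally
monotone because its alternating differences are extensions of stable functions. -/
theorem IsUniversalStable.exists_tens_lift {p : Ball P.toPosCone → Ball X.toPosCone}
    {q : Ball Q.toPosCone → Ball Y.toPosCone} (hp : IsUniversalStable p)
    (hq : IsUniversalStable q) {f : Ball (withObj P Q).toPosCone → S} (hf : IsStable f)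
    (h1 : ∀ v, ‖f v‖₊ ≤ 1) :
    ∃ h : tens X Y ⟶ S, ∀ x y, h (tmk (p x).1 (q y).1) = f (ballPair x y) := by
  -- `E x` extends `f (x, ·)`, and `F x` is the same map as an element of `Y ⊸ S`.
  choose E hE using fun x => hq.exists_lift _ (isStable_ballPair_left hf x) fun y => h1 _
  let F : Ball P.toPosCone → limpl Y S := fun x => (E x).toLinMap
  have hF : ∀ x y, F x (q y).1 = f (ballPair x y) := hE
  have hF1 : ∀ x, ‖F x‖₊ ≤ 1 := fun x => (LinMap.nnnorm_le_iff _ _).2 (E x).map_ball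
  have htot : ∀ (n : ℕ) (x : Fin n → P) (hx : ‖∑ i, x i‖₊ ≤ 1),
      oddSum Finset.univ (fun I => F (ballSum x hx I)) ≤
        evenSum Finset.univ (fun I => F (ballSum x hx I)) := by
    intro n x hx
    obtain ⟨d, hd, hd'⟩ := exists_isStable_difference hf x hx
    obtain ⟨D, hD⟩ := hq.exists_linMap hd
    refine ⟨D, hq.linMap_ext _ _ fun y => ?_⟩
    have e1 := (LinMap.eval Y.toCompleteCone S.toCompleteCone (q y).1).map_oddSum Finset.univ
      fun I => F (ballSum x hx I)
    have e2 := (LinMap.eval Y.toCompleteCone S.toCompleteCone (q y).1).map_evenSum Finset.univ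
      fun I => F (ballSum x hx I)
    exact (congrArg₂ (· + ·) (e1.trans (oddSum_congr fun I _ => hF _ y)) (hD y)).trans
      ((hd' y).trans (e2.trans (evenSum_congr fun I _ => hF _ y)).symm)
  have hmono := monotone_of_totallyMonotone htot
  have hst : IsStable F := by
    refine ⟨⟨1, hF1⟩, htot, fun x a hx ha => ?_⟩
    obtain ⟨g, -, hg⟩ := LinMap.exists_pointwise_lub (u := fun n => (E (x n)).toLinMap)
      (fun z m n hmn => by
        obtain ⟨k, hk⟩ := hmono (hx hmn)
        exact ⟨(show LinMap _ _ from k) z, DFunLike.congr_fun hk z⟩) 1 fun n => hF1 _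
    -- The pointwise least upper bound of the `E (x n)` agrees with `E a` on the image of `q`.
    have hga : g = (E a).toLinMap := hq.linMap_ext _ _ fun y => by
      refine (hg (q y).1).unique ?_
      have := (isStable_ballPair_right hf y).continuous x a hx ha
      simp only [← hE] at this
      exact this
    rw [hga] at hg
    exact isLUB_of_reflects_le (LinMap.eval _ _) (fun _ _ => LinMap.le_of_apply_le) hg
  obtain ⟨G, hG⟩ := hp.exists_lift F hst hF1
  refine ⟨tensLift G, fun x y => ?_⟩
  rw [tensLift_tmk, hG, hF]

/-- The tensor product of universal stable maps out of `P` and `Q` is a universal stable map out of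
`P & Q`. -/
theorem IsUniversalStable.tens {p : Ball P.toPosCone → Ball X.toPosCone}
    {q : Ball Q.toPosCone → Ball Y.toPosCone} (hp : IsUniversalStable p)
    (hq : IsUniversalStable q) :
    IsUniversalStable (P := withObj P Q) (X := tens X Y) fun v =>
      ⟨tmk (p ⟨v.1.1, (le_max_left _ _).trans v.2⟩).1 (q ⟨v.1.2, (le_max_right _ _).trans v.2⟩).1,
        nnnorm_tmk_le_one (p _).2 (q _).2⟩ where
  isStable := (isStable_tmk X Y).comp
    (f := fun v : Ball (withObj P Q).toPosCone =>
      ballPair (p ⟨v.1.1, (le_max_left _ _).trans v.2⟩) (q ⟨v.1.2, (le_max_right _ _).trans v.2⟩))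
    (IsStable.pair
      (hp.isStable.comp (f := fun v : Ball (withObj P Q).toPosCone =>
        (⟨v.1.1, (le_max_left _ _).trans v.2⟩ : Ball P.toPosCone))
        (fstMap P.toCompleteCone Q.toCompleteCone).isStable)
      (hq.isStable.comp (f := fun v : Ball (withObj P Q).toPosCone =>
        (⟨v.1.2, (le_max_right _ _).trans v.2⟩ : Ball Q.toPosCone))
        (sndMap P.toCompleteCone Q.toCompleteCone).isStable))
  exists_lift f hf h1 := by
    obtain ⟨h, hh⟩ := hp.exists_tens_lift hq hf h1
    exact ⟨h, fun v => hh _ _⟩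
  linMap_ext h k H := tens_linMap_ext fun s t => by
    have H1 : ∀ x : Ball P.toPosCone, h.comp (tensMap (p x).1) = k.comp (tensMap (p x).1) :=
      fun x => hq.linMap_ext _ _ fun y => H (ballPair x y)
    have H2 : h.comp (tensMapFlip t) = k.comp (tensMapFlip t) :=
      hp.linMap_ext _ _ fun x => DFunLike.congr_fun (H1 x) t
    exact DFunLike.congr_fun H2 s

theorem IsUniversalStable.tens_hom_ext {p : Ball P.toPosCone → Ball X.toPosCone}
    {q : Ball Q.toPosCone → Ball Y.toPosCone} (hp : IsUniversalStable p)
    (hq : IsUniversalStable q) {h k : Cones.tens X Y ⟶ S}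
    (H : ∀ x y, h (tmk (p x).1 (q y).1) = k (tmk (p x).1 (q y).1)) : h = k :=
  (hp.tens hq).hom_ext fun _ => H _ _

theorem IsUniversalStable.tens_hom_ext₃ {R Z : SCCLin.{u}} {p : Ball P.toPosCone → Ball X.toPosCone}
    {q : Ball Q.toPosCone → Ball Y.toPosCone} {r : Ball R.toPosCone → Ball Z.toPosCone}
    (hp : IsUniversalStable p) (hq : IsUniversalStable q) (hr : IsUniversalStable r)
    {h k : Cones.tens (Cones.tens X Y) Z ⟶ S}
    (H : ∀ x y z, h (tmk (tmk (p x).1 (q y).1) (r z).1) = k (tmk (tmk (p x).1 (q y).1) (r z).1)) :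
    h = k :=
  ((hp.tens hq).tens hr).hom_ext fun _ => H _ _ _

end TwoVariables

/-- The constant function `1` is a universal stable map out of the zero cone. -/
theorem isUniversalStable_one : IsUniversalStable (P := topCone.{u}) (X := unitCone.{u})
    fun _ => ⟨unitOne, le_rfl⟩ where
  isStable := IsStable.const _
  exists_lift f _ h1 := ⟨⟨unitSmul (f topZero), fun r hr => by
    refine (nnnorm_smul' _ _).trans_le (mul_le_one' ?_ (h1 _))
    exact hr⟩, fun _ => one_smul _ _⟩
  linMap_ext h k H := LinMap.ext fun r => by
    rw [← unitVal_smul_unitOne r, LinMap.map_smul, LinMap.map_smul]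
    exact congrArg (unitVal r • ·) (H topZero)

/-! ### The left adjoint of the forgetful functor -/

/-- Stable morphisms out of `P` correspond to linear morphisms out of the target of a universal
stable map. -/
noncomputable def IsUniversalStable.homEquiv {P X : SCCLin.{u}}
    {p : Ball P.toPosCone → Ball X.toPosCone} (hp : IsUniversalStable p) (S : SCCLin.{u}) :
    (X ⟶ S) ≃ StabHom P S where
  toFun h := ⟨fun x => ⟨h (p x).1, h.map_ball _ (p x).2⟩, hp.isStable.linMap_comp h.toLinMap⟩
  invFun f := (hp.exists_lift (fun x => (f.toFun x).1) f.isStable fun x => (f.toFun x).2).choose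
  left_inv h := hp.hom_ext (hp.exists_lift (fun x => h (p x).1)
    (hp.isStable.linMap_comp h.toLinMap) fun x => h.map_ball _ (p x).2).choose_spec
  right_inv f := by
    refine DFunLike.coe_injective (F := (⟨P⟩ : SCCStab.{u}) ⟶ ⟨S⟩) (funext fun x => ?_)
    exact Subtype.ext ((hp.exists_lift (fun x => (f.toFun x).1) f.isStable
      fun x => (f.toFun x).2).choose_spec x)

theorem isRightAdjoint_stabOfLin : stabOfLin.{u}.IsRightAdjoint := by
  choose X p hp using exists_isUniversalStable.{u}
  exact (Adjunction.adjunctionOfEquivLeft (G := stabOfLin.{u}) (F_obj := fun P => X P.cone)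
    (fun P S => (hp P.cone).homEquiv S) fun _ _ _ _ _ => rfl).isRightAdjoint

section Exponential

variable {L : SCCStab.{u} ⥤ SCCLin.{u}} (adj : L ⊣ stabOfLin.{u})

theorem prom_homEquiv {P S : SCCLin.{u}} (h : (bang adj).obj P ⟶ S) (x : Ball P.toPosCone) :
    (adj.homEquiv (stabOfLin.obj P) S h x).1 = h (prom adj x).1 := by
  have key : adj.homEquiv (stabOfLin.obj P) S h =
      adj.homEquiv (stabOfLin.obj P) ((bang adj).obj P) (𝟙 _) ≫ stabOfLin.map h :=
    (congrArg _ (Category.id_comp h).symm).trans (adj.homEquiv_naturality_right _ _)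
  exact congrArg (fun g : stabOfLin.obj P ⟶ stabOfLin.obj S => (g x).1) key

theorem homEquiv_symm_prom {P S : SCCLin.{u}} (g : stabOfLin.obj P ⟶ stabOfLin.obj S)
    (x : Ball P.toPosCone) :
    (show (bang adj).obj P ⟶ S from (adj.homEquiv (stabOfLin.obj P) S).symm g) (prom adj x).1 =
      (g x).1 :=
  (prom_homEquiv adj _ x).symm.trans (congrArg
    (fun g : stabOfLin.obj P ⟶ stabOfLin.obj S => (g x).1) (Equiv.apply_symm_apply _ g))

/-- Morphisms out of `!P` are determined by their values on the elements `!x`. -/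
theorem bang_hom_ext {P S : SCCLin.{u}} {h k : (bang adj).obj P ⟶ S}
    (H : ∀ x, h (prom adj x).1 = k (prom adj x).1) : h = k :=
  (adj.homEquiv (stabOfLin.obj P) S).injective (DFunLike.ext _ _ fun x => Subtype.ext
    ((prom_homEquiv adj h x).trans ((H x).trans (prom_homEquiv adj k x).symm)))

/-- The unit of an adjunction to the forgetful functor is a universal stable map. -/
theorem isUniversalStable_prom (P : SCCLin.{u}) :
    IsUniversalStable (X := (bang adj).obj P) fun x : Ball P.toPosCone => prom adj x where
  isStable := (adj.homEquiv (stabOfLin.obj P) ((bang adj).obj P) (𝟙 _)).isStable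
  exists_lift f hf h1 := ⟨(adj.homEquiv _ _).symm (StabHom.mk (fun x => ⟨f x, h1 x⟩) hf),
    fun x => homEquiv_symm_prom adj _ x⟩
  linMap_ext {S} h k H := by
    -- After rescaling, both maps are morphisms.
    set c : ℝ≥0 := ‖h‖₊ + ‖k‖₊ + 1 with hc
    have hc0 : c ≠ 0 := by positivity
    have hball : ∀ l : LinMap ((bang adj).obj P).toCompleteCone S.toCompleteCone, ‖l‖₊ ≤ c →
        ∀ z, ‖z‖₊ ≤ 1 → ‖(c⁻¹ • l) z‖₊ ≤ 1 := fun l hl z hz => by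
      rw [LinMap.smul_apply, nnnorm_smul', inv_mul_le_iff₀ (pos_iff_ne_zero.2 hc0), mul_one]
      exact ((l.nnnorm_le_iff _).1 le_rfl z hz).trans hl
    have hk : ‖h‖₊ ≤ c := le_add_right le_self_add
    have hk' : ‖k‖₊ ≤ c := le_add_right le_add_self
    have key : (⟨c⁻¹ • h, hball h hk⟩ : (bang adj).obj P ⟶ S) = ⟨c⁻¹ • k, hball k hk'⟩ :=
      bang_hom_ext adj fun x => congrArg (c⁻¹ • ·) (H x)
    have key' : c⁻¹ • h = c⁻¹ • k := congrArg LinHom.toLinMap key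
    have := congrArg (c • ·) key'
    simpa [smul_smul, hc0] using this

theorem map_prom {P Q : SCCLin.{u}} (g : stabOfLin.obj P ⟶ stabOfLin.obj Q)
    (x : Ball P.toPosCone) :
    (show (bang adj).obj P ⟶ (bang adj).obj Q from L.map g) (prom adj x).1 =
      (prom adj (show Ball Q.toPosCone from g x)).1 := by
  have key : adj.homEquiv (stabOfLin.obj P) ((bang adj).obj Q) (L.map g) =
      g ≫ adj.homEquiv (stabOfLin.obj Q) ((bang adj).obj Q) (𝟙 _) :=
    (congrArg _ (Category.comp_id (L.map g)).symm).trans (adj.homEquiv_naturality_left _ _)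
  exact (prom_homEquiv adj (L.map g) x).symm.trans
    (congrArg (fun g : stabOfLin.obj P ⟶ stabOfLin.obj ((bang adj).obj Q) => (g x).1) key)

/-- The action of a morphism on unit balls. -/
def ballMap {P Q : SCCLin.{u}} (f : P ⟶ Q) (x : Ball P.toPosCone) : Ball Q.toPosCone :=
  ⟨f x.1, f.map_ball _ x.2⟩

theorem bang_map_prom {P Q : SCCLin.{u}} (f : P ⟶ Q) (x : Ball P.toPosCone) :
    (bang adj).map f (prom adj x).1 = (prom adj (ballMap f x)).1 :=
  map_prom adj (stabOfLin.map f) x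

theorem bang_δ_prom {P : SCCLin.{u}} (x : Ball P.toPosCone) :
    (bang adj).δ.app P (prom adj x).1 = (prom adj (prom adj x)).1 := by
  refine (map_prom adj (adj.unit.app (stabOfLin.obj P)) x).trans ?_
  rw [← adj.homEquiv_id]
  rfl

end Exponential

/-! ### The Seely isomorphisms -/

section Seely

variable {L : SCCStab.{u} ⥤ SCCLin.{u}} (adj : L ⊣ stabOfLin.{u}) (P Q R : SCCLin.{u})

/-- The isomorphism `!P ⊗ !Q ≅ !(P & Q)`, which maps `!x ⊗ !y` to `!(x, y)`. -/
noncomputable def seelyIso :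
    tens ((bang adj).obj P) ((bang adj).obj Q) ≅ (bang adj).obj (withObj P Q) :=
  ((isUniversalStable_prom adj P).tens (isUniversalStable_prom adj Q)).iso
    (isUniversalStable_prom adj (withObj P Q))

/-- The isomorphism `1 ≅ !⊤`, which maps `1` to `!0`. -/
noncomputable def seelyUnitIso : unitCone.{u} ≅ (bang adj).obj topCone.{u} :=
  isUniversalStable_one.iso (isUniversalStable_prom adj topCone)

variable {P Q R}

@[simp] theorem seelyIso_hom_tmk (x : Ball P.toPosCone) (y : Ball Q.toPosCone) :
    (seelyIso adj P Q).hom (tmk (prom adj x).1 (prom adj y).1) = (prom adj (ballPair x y)).1 :=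
  IsUniversalStable.iso_hom_apply _ _ (ballPair x y)

@[simp] theorem seelyUnitIso_hom_unitOne :
    (seelyUnitIso adj).hom unitOne.{u} = (prom adj topZero).1 :=
  IsUniversalStable.iso_hom_apply _ _ topZero

theorem seely_naturality {P' Q' : SCCLin.{u}} (f : P ⟶ P') (g : Q ⟶ Q') :
    tensHomMap ((bang adj).map f) ((bang adj).map g) ≫ (seelyIso adj P' Q').hom =
      (seelyIso adj P Q).hom ≫ (bang adj).map (withLift (withFst P Q ≫ f) (withSnd P Q ≫ g)) :=
  IsUniversalStable.tens_hom_ext (isUniversalStable_prom adj _) (isUniversalStable_prom adj _) fun x y => by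
    simp only [comp_apply', tensHomMap_tmk, bang_map_prom, seelyIso_hom_tmk]
    rfl

theorem seely_naturality_left {P' : SCCLin.{u}} (f : P ⟶ P') :
    tensHomMap ((bang adj).map f) (𝟙 ((bang adj).obj Q)) ≫ (seelyIso adj P' Q).hom =
      (seelyIso adj P Q).hom ≫ (bang adj).map (withLift (withFst P Q ≫ f) (withSnd P Q)) := by
  rw [← CategoryTheory.Functor.map_id]
  exact seely_naturality adj f (𝟙 Q)

theorem seely_naturality_right {Q' : SCCLin.{u}} (g : Q ⟶ Q') :
    tensHomMap (𝟙 ((bang adj).obj P)) ((bang adj).map g) ≫ (seelyIso adj P Q').hom =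
      (seelyIso adj P Q).hom ≫ (bang adj).map (withLift (withFst P Q) (withSnd P Q ≫ g)) := by
  rw [← CategoryTheory.Functor.map_id]
  exact seely_naturality adj (𝟙 P) g

theorem seely_associativity :
    tensHomMap (seelyIso adj P Q).hom (𝟙 ((bang adj).obj R)) ≫
        (seelyIso adj (withObj P Q) R).hom ≫
        (bang adj).map (withLift (withFst (withObj P Q) R ≫ withFst P Q)
          (withLift (withFst (withObj P Q) R ≫ withSnd P Q) (withSnd (withObj P Q) R))) =
      tensAssoc ((bang adj).obj P) ((bang adj).obj Q) ((bang adj).obj R) ≫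
        tensHomMap (𝟙 ((bang adj).obj P)) (seelyIso adj Q R).hom ≫
        (seelyIso adj P (withObj Q R)).hom :=
  IsUniversalStable.tens_hom_ext₃ (isUniversalStable_prom adj _) (isUniversalStable_prom adj _) (isUniversalStable_prom adj _)
    fun x y z => by
    simp only [comp_apply', tensHomMap_tmk, tensAssoc_tmk, id_apply', seelyIso_hom_tmk,
      bang_map_prom]
    rfl

theorem seely_braided :
    (seelyIso adj P Q).hom ≫ (bang adj).map (withLift (withSnd P Q) (withFst P Q)) =
      tensSwap ((bang adj).obj P) ((bang adj).obj Q) ≫ (seelyIso adj Q P).hom :=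
  IsUniversalStable.tens_hom_ext (isUniversalStable_prom adj _) (isUniversalStable_prom adj _) fun x y => by
    simp only [comp_apply', tensSwap_tmk, seelyIso_hom_tmk, bang_map_prom]
    rfl

theorem seely_left_unitality :
    tensUnit ((bang adj).obj P) =
      tensHomMap (seelyUnitIso adj).hom (𝟙 ((bang adj).obj P)) ≫
        (seelyIso adj topCone P).hom ≫ (bang adj).map (withSnd topCone P) :=
  isUniversalStable_one.tens_hom_ext (isUniversalStable_prom adj P) fun x y => by
    simp only [comp_apply', tensUnit_tmk, tensHomMap_tmk, id_apply', seelyUnitIso_hom_unitOne,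
      seelyIso_hom_tmk, bang_map_prom, unitVal_unitOne, one_smul]
    rfl

theorem seely_right_unitality :
    tensSwap ((bang adj).obj P) unitCone ≫ tensUnit ((bang adj).obj P) =
      tensHomMap (𝟙 ((bang adj).obj P)) (seelyUnitIso adj).hom ≫
        (seelyIso adj P topCone).hom ≫ (bang adj).map (withFst P topCone) :=
  (isUniversalStable_prom adj P).tens_hom_ext isUniversalStable_one fun x y => by
    simp only [comp_apply', tensSwap_tmk, tensUnit_tmk, tensHomMap_tmk, id_apply',
      seelyUnitIso_hom_unitOne, seelyIso_hom_tmk, bang_map_prom, unitVal_unitOne, one_smul]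
    rfl

/-- The Seely isomorphisms are compatible with digging. -/
theorem seely_digging :
    (seelyIso adj P Q).hom ≫ (bang adj).δ.app (withObj P Q) ≫
        (bang adj).map (withLift ((bang adj).map (withFst P Q)) ((bang adj).map (withSnd P Q))) =
      tensHomMap ((bang adj).δ.app P) ((bang adj).δ.app Q) ≫
        (seelyIso adj ((bang adj).obj P) ((bang adj).obj Q)).hom :=
  IsUniversalStable.tens_hom_ext (isUniversalStable_prom adj _) (isUniversalStable_prom adj _) fun x y => by
    have h1 : ballMap (withLift ((bang adj).map (withFst P Q)) ((bang adj).map (withSnd P Q)))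
        (prom adj (ballPair x y)) = ballPair (prom adj x) (prom adj y) :=
      Subtype.ext (Prod.ext (bang_map_prom adj (withFst P Q) (ballPair x y))
        (bang_map_prom adj (withSnd P Q) (ballPair x y)))
    simp only [comp_apply', tensHomMap_tmk, seelyIso_hom_tmk, bang_δ_prom]
    refine (bang_map_prom adj _ (prom adj (ballPair x y))).trans ?_
    rw [h1]
    exact (seelyIso_hom_tmk adj (prom adj x) (prom adj y)).symm

attribute [local instance] tensorMonoidal tensorSymmetric

/-- The strong symmetric monoidal structure on the exponential. -/
noncomputable abbrev seelyBraided : (bangWith adj).Braided where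
  toMonoidal := Functor.CoreMonoidal.toMonoidal
    { εIso := seelyUnitIso adj
      μIso := seelyIso adj
      μIso_hom_natural_left := fun f _ => seely_naturality_left adj f
      μIso_hom_natural_right := fun _ f => seely_naturality_right adj f
      associativity := fun _ _ _ => seely_associativity adj
      left_unitality := fun _ => seely_left_unitality adj
      right_unitality := fun _ => seely_right_unitality adj }
  braided _ _ := seely_braided adj

end Seely

/-! ### The comparison with the Kleisli category -/

theorem isEquivalence_kleisliComparison {L : SCCStab.{u} ⥤ SCCLin.{u}} (adj : L ⊣ stabOfLin.{u}) :
    (kleisliComparison adj).IsEquivalence where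
  faithful := ⟨fun h => Cokleisli.hom_ext _ ((adj.homEquiv _ _).injective h)⟩
  full := ⟨fun g => ⟨⟨(adj.homEquiv _ _).symm g⟩, (adj.homEquiv _ _).apply_symm_apply g⟩⟩
  essSurj := ⟨fun P => ⟨Cokleisli.mk _ P.cone, ⟨Iso.refl _⟩⟩⟩

end Cones

open Cones
theorem mainTheorem6 :
    stabOfLin.{u}.IsRightAdjoint ∧
    ∃ (_ : MonoidalCategory SCCLin.{u}) (_ : SymmetricCategory SCCLin.{u})
      (T : ConeTensor.{u}),
      ∀ (L : SCCStab.{u} ⥤ SCCLin.{u}) (adj : L ⊣ stabOfLin.{u}),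
        (∃ _ : (bangWith adj).Braided,
          ((Functor.LaxMonoidal.ε (bangWith adj) : 𝟙_ SCCLin.{u} ⟶ (bang adj).obj topCone)
            (T.unitIso.hom ⟨1⟩) = (prom adj topZero).1) ∧
          (∀ (P Q : SCCLin.{u}) (x : Ball P.toPosCone) (y : Ball Q.toPosCone),
            (Functor.LaxMonoidal.μ (bangWith adj) P Q :
                (bang adj).obj P ⊗ (bang adj).obj Q ⟶ (bang adj).obj (withObj P Q))
              (pureTensor T.adj (prom adj x).1 (prom adj y).1) =
                (prom adj (ballPair x y)).1) ∧
          (∀ P Q : SCCLin.{u},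
            (Functor.LaxMonoidal.μ (bangWith adj) P Q :
                (bang adj).obj P ⊗ (bang adj).obj Q ⟶ (bang adj).obj (withObj P Q)) ≫
              (bang adj).δ.app (withObj P Q) ≫
                (bang adj).map
                  (withLift ((bang adj).map (withFst P Q)) ((bang adj).map (withSnd P Q))) =
            ((bang adj).δ.app P ⊗ₘ (bang adj).δ.app Q) ≫
              Functor.LaxMonoidal.μ (bangWith adj) ((bang adj).obj P) ((bang adj).obj Q))) ∧
        (kleisliComparison adj).IsEquivalence := by
  refine ⟨isRightAdjoint_stabOfLin, tensorMonoidal, tensorSymmetric, coneTensor, fun L adj =>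
    ⟨⟨seelyBraided adj, seelyUnitIso_hom_unitOne adj, fun P Q x y => ?_,
      fun P Q => seely_digging adj⟩, isEquivalence_kleisliComparison adj⟩⟩
  exact seelyIso_hom_tmk adj x y
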